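/- Let $\Gamma$ be a group with identity $\varepsilon$, let $R$ be a commutative ring with $1$, and let $\mathcal G$ be a $\Gamma$-graded ample groupoid: a topological groupoid with domain map $\mathbf d$ and codomain map $\mathbf c$ such that $\mathbf d$ is a local homeomorphism, the unit space $\mathcal G^{(0)}$ is Hausdorff and the compact open bisections form a basis of the topology, together with a continuous functor $\kappa:\mathcal G\to\Gamma$ to the discrete group $\Gamma$; put $\mathcal G_\gamma=\kappa^{-1}(\gamma)$. Let $A_R(\mathcal G)$ be the Steinberg algebra, i.e. the $R$-span in $R^{\mathcal G}$ of the characteristic functions $\mathbf 1_B$ of compact open bisections $B$, with the convolution $(f*g)(x)=\sum_{\mathbf d(y)=\mathbf d(x)}f(xy^{-1})g(y)$, graded by $A_R(\mathcal G)_\gamma=\{f\mid \operatorname{supp} f\subseteq\mathcal G_\gamma\}$. Let $\operatorname{Gr}A_R(\mathcal G)$ be the category of right $A_R(\mathcal G)$-modules $M$ that are unital ($M=MA_R(\mathcal G)$) and graded ($M=\bigoplus_\gamma M_\gamma$, $M_\gamma A_R(\mathcal G)_\delta\subseteq M_{\gamma\delta}$), with degree-preserving homomorphisms. Let $\operatorname{Gr}_R\mathcal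 G$ be the category of graded $\mathcal G$-sheaves of $R$-modules: sheaf spaces $p:E\to\mathcal G^{(0)}$ of $R$-modules with a continuous right action of $\mathcal G$ by $R$-linear maps $E_{\mathbf c(g)}\to E_{\mathbf d(g)}$, $e\mapsto eg$, and with decompositions $E_x=\bigoplus_\gamma (E_x)_\gamma$ into $R$-submodules such that each $E_\gamma=\bigcup_x (E_x)_\gamma$ is open in $E$ and $E_\gamma\mathcal G_\delta\subseteq E_{\gamma\delta}$; morphisms are the degree-preserving $\mathcal G$-equivariant morphisms of sheaves of $R$-modules. For a $\mathcal G$-sheaf of $R$-modules $E$, let $\Gamma_c(E)$ be the right $A_R(\mathcal G)$-module of compactly supported continuous sections $s:\mathcal G^{(0)}\to E$, with $(sf)(x)=\sum_{\mathbf d(g)=x}f(g)\,s(\mathbf c(g))g$ and $\Gamma_c(\phi)(s)=\phi\circ s$. For a unital right $A_R(\mathcal G)$-module $M$, let $\operatorname{Sh}(M)$ be the $\mathcal G$-sheaf of $R$-modules whose stalk at $x$ is $\varinjlim_{U\ni x}M\mathbf 1_U$ ($U\subseteq\mathcal G^{(0)}$ compact open), with germs denoted $[m]_x$, with the topology generated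 by the sets $\{[m]_x\mid x\in U\}$ ($U$ compact open, $m\in M\mathbf 1_U$), the action $[m]_{\mathbf c(g)}\,g=[m\mathbf 1_B]_{\mathbf d(g)}$ for any compact open bisection $B\ni g$, and $\operatorname{Sh}(f)([m]_x)=[f(m)]_x$. If $E$ is graded, $\Gamma_c(E)$ is graded by $\Gamma_c(E)_\gamma=\{s\mid s(\mathcal G^{(0)})\subseteq E_\gamma\}$; if $M$ is graded, $\operatorname{Sh}(M)$ is graded by $(\operatorname{Sh}(M)_x)_\gamma=\{[m]_x\mid m\in M_\gamma\}$. For $\alpha\in\Gamma$ let $\mathcal T_\alpha$ denote the shift functors $M\mapsto M(\alpha)$, $M(\alpha)_\gamma=M_{\alpha\gamma}$, and $E\mapsto E(\alpha)$, $(E(\alpha)_x)_\gamma=(E_x)_{\alpha\gamma}$. **Proposition.** With these gradings, $\Gamma_c$ and $\operatorname{Sh}$ restrict to functors $\Gamma_c:\operatorname{Gr}_R\mathcal G\to\operatorname{Gr}A_R(\mathcal G)$ and $\operatorname{Sh}:\operatorname{Gr}A_R(\mathcal G)\to\operatorname{Gr}_R\mathcal G$ (they are compatible with the functors that forget the gradings)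 that are mutually inverse equivalences of categories. Moreover, for every $\alpha\in\Gamma$, $\Gamma_c\circ\mathcal T_\alpha=\mathcal T_\alpha\circ\Gamma_c$ and $\operatorname{Sh}\circ\mathcal T_\alpha=\mathcal T_\alpha\circ\operatorname{Sh}$. -/

import Mathlib

open CategoryTheory Topology

universe u v w t a

/-! ### Topological groupoids -/

/-- A topological groupoid: a small category in which every arrow is invertible, with a topology on
the set `Arr` of arrows making inversion and composition continuous. `comp g h` is the composite
`gh`, defined when `d g = c h`. The object space `Obj` (the unit space) is identified with the set
of identity arrows through `one` and carries the relative topology. -/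
structure TopGroupoid : Type (u + 1) where
  Arr : Type u
  Obj : Type u
  [topArr : TopologicalSpace Arr]
  [topObj : TopologicalSpace Obj]
  d : Arr → Obj
  c : Arr → Obj
  one : Obj → Arr
  inv : Arr → Arr
  comp : ∀ g h : Arr, d g = c h → Arr
  d_one : ∀ x, d (one x) = x
  c_one : ∀ x, c (one x) = x
  d_inv : ∀ g, d (inv g) = c g
  c_inv : ∀ g, c (inv g) = d g
  d_comp : ∀ g h (e : d g = c h), d (comp g h e) = d h
  c_comp : ∀ g h (e : d g = c h), c (comp g h e) = c g
  one_comp : ∀ g, comp (one (c g)) g (d_one _) = g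
  comp_one : ∀ g, comp g (one (d g)) (c_one _).symm = g
  comp_assoc : ∀ g h k (e : d g = c h) (e' : d h = c k),
    comp (comp g h e) k ((d_comp g h e).trans e') = comp g (comp h k e') (e.trans (c_comp h k e').symm)
  inv_comp : ∀ g, comp (inv g) g (d_inv g) = one (d g)
  comp_inv : ∀ g, comp g (inv g) (c_inv g).symm = one (c g)
  isEmbedding_one : IsEmbedding one
  continuous_inv : Continuous inv
  continuous_comp :
    Continuous fun p : {p : Arr × Arr // d p.1 = c p.2} => comp p.1.1 p.1.2 p.2

namespace TopGroupoid

attribute [instance] topArr topObj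

variable (𝒢 : TopGroupoid.{u})

/-- An open bisection: an open set of arrows on which `d` and `c` are injective. -/
def IsOpenBisection (B : Set 𝒢.Arr) : Prop :=
  IsOpen B ∧ Set.InjOn 𝒢.d B ∧ Set.InjOn 𝒢.c B

/-- The set `B^co(𝒢)` of compact open bisections. -/
def compactOpenBisections : Set (Set 𝒢.Arr) :=
  {B | IsCompact B ∧ 𝒢.IsOpenBisection B}

/-- An ample groupoid: an étale groupoid with Hausdorff unit space, whose topology has a basis of
compact open bisections. -/
class IsAmple : Prop where
  isLocalHomeomorph_d : IsLocalHomeomorph 𝒢.d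
  t2Space_obj : T2Space 𝒢.Obj
  isTopologicalBasis : TopologicalSpace.IsTopologicalBasis 𝒢.compactOpenBisections

/-- A grading of a topological groupoid by a (discrete) group `Γ`: a continuous functor `κ` to `Γ`.
The component of degree `γ` is the clopen set of arrows `g` with `κ g = γ`. -/
structure Grading (Γ : Type t) [Group Γ] where
  deg : 𝒢.Arr → Γ
  deg_comp : ∀ g h (e : 𝒢.d g = 𝒢.c h), deg (𝒢.comp g h e) = deg g * deg h
  isLocallyConstant_deg : IsLocallyConstant deg

variable {𝒢}

/-- The set `1_U` of identity arrows at the points of `U`. -/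
def units (U : Set 𝒢.Obj) : Set 𝒢.Arr := 𝒢.one '' U

/-- The product `BC = {bc | b ∈ B, c ∈ C composable}` of two sets of arrows. -/
def setMul (B C : Set 𝒢.Arr) : Set 𝒢.Arr :=
  {g | ∃ b ∈ B, ∃ k ∈ C, ∃ e : 𝒢.d b = 𝒢.c k, 𝒢.comp b k e = g}

theorem comp_congr {g g' h h' : 𝒢.Arr} (e : 𝒢.d g = 𝒢.c h) (hg : g = g') (hh : h = h') :
    𝒢.comp g h e = 𝒢.comp g' h' (hg ▸ hh ▸ e) := by subst hg hh; rfl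

theorem comp_one' (g : 𝒢.Arr) (x : 𝒢.Obj) (e : 𝒢.d g = 𝒢.c (𝒢.one x)) :
    𝒢.comp g (𝒢.one x) e = g := by
  have hx : x = 𝒢.d g := by rw [e, 𝒢.c_one]
  subst hx; exact 𝒢.comp_one g

theorem one_comp' (g : 𝒢.Arr) (x : 𝒢.Obj) (e : 𝒢.d (𝒢.one x) = 𝒢.c g) :
    𝒢.comp (𝒢.one x) g e = g := by
  have hx : x = 𝒢.c g := by rw [← e, 𝒢.d_one]
  subst hx; exact 𝒢.one_comp g

theorem comp_comp_inv (g h : 𝒢.Arr) (e : 𝒢.d g = 𝒢.c h) :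
    𝒢.comp (𝒢.comp g h e) (𝒢.inv h) ((𝒢.d_comp g h e).trans (𝒢.c_inv h).symm) = g := by
  rw [𝒢.comp_assoc g h (𝒢.inv h) e (𝒢.c_inv h).symm, comp_congr _ rfl (𝒢.comp_inv h)]
  exact comp_one' _ _ _

theorem comp_inv_comp (g h : 𝒢.Arr) (e : 𝒢.d g = 𝒢.d h) :
    𝒢.comp (𝒢.comp g (𝒢.inv h) (e.trans (𝒢.c_inv h).symm)) h
      ((𝒢.d_comp _ _ _).trans (𝒢.d_inv h)) = g := by
  rw [𝒢.comp_assoc g (𝒢.inv h) h _ (𝒢.d_inv h), comp_congr _ rfl (𝒢.inv_comp h)]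
  exact comp_one' _ _ _

variable (𝒢) in
theorem continuous_d : Continuous 𝒢.d := by
  rw [𝒢.isEmbedding_one.continuous_iff]
  have : (𝒢.one ∘ 𝒢.d) = fun g => 𝒢.comp (𝒢.inv g) g (𝒢.d_inv g) := by
    funext g; exact (𝒢.inv_comp g).symm
  rw [this]
  exact 𝒢.continuous_comp.comp
    (f := fun g => (⟨(𝒢.inv g, g), 𝒢.d_inv g⟩ : {p : 𝒢.Arr × 𝒢.Arr // 𝒢.d p.1 = 𝒢.c p.2}))
    ((𝒢.continuous_inv.prodMk continuous_id).subtype_mk _)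

variable (𝒢) in
theorem continuous_c : Continuous 𝒢.c := by
  have : 𝒢.c = 𝒢.d ∘ 𝒢.inv := by funext g; exact (𝒢.d_inv g).symm
  rw [this]; exact 𝒢.continuous_d.comp 𝒢.continuous_inv

theorem Grading.deg_one {Γ : Type t} [Group Γ] (κ : 𝒢.Grading Γ) (x : 𝒢.Obj) :
    κ.deg (𝒢.one x) = 1 := by
  have h := κ.deg_comp (𝒢.one x) (𝒢.one x) ((𝒢.d_one x).trans (𝒢.c_one x).symm)
  rw [comp_one'] at h
  exact mul_eq_left.1 h.symm

section Ample

variable [𝒢.IsAmple]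

instance instT2SpaceObj : T2Space 𝒢.Obj := IsAmple.t2Space_obj

variable (𝒢) in
theorem isOpenEmbedding_one : IsOpenEmbedding 𝒢.one := by
  refine ⟨𝒢.isEmbedding_one, ?_⟩
  rw [isOpen_iff_mem_nhds]
  rintro _ ⟨x, rfl⟩
  obtain ⟨B, ⟨-, hBo, hBd, -⟩, hxB, -⟩ :=
    (IsAmple.isTopologicalBasis (𝒢 := 𝒢)).exists_subset_of_mem_open (Set.mem_univ (𝒢.one x))
      isOpen_univ
  have h1 : B ∈ 𝓝 (𝒢.one x) := hBo.mem_nhds hxB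
  have h2 : (fun g => 𝒢.one (𝒢.d g)) ⁻¹' B ∈ 𝓝 (𝒢.one x) :=
    (hBo.preimage (𝒢.isEmbedding_one.continuous.comp 𝒢.continuous_d)).mem_nhds
      (by simpa [𝒢.d_one] using hxB)
  filter_upwards [h1, h2] with g hg hg'
  exact ⟨𝒢.d g, hBd hg' hg (𝒢.d_one _)⟩

theorem units_mem {U : Set 𝒢.Obj} (hc : IsCompact U) (ho : IsOpen U) :
    units U ∈ 𝒢.compactOpenBisections := by
  refine ⟨hc.image 𝒢.isEmbedding_one.continuous, 𝒢.isOpenEmbedding_one.isOpenMap _ ho, ?_, ?_⟩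
  · rintro _ ⟨x, -, rfl⟩ _ ⟨y, -, rfl⟩ h
    rw [𝒢.d_one, 𝒢.d_one] at h; rw [h]
  · rintro _ ⟨x, -, rfl⟩ _ ⟨y, -, rfl⟩ h
    rw [𝒢.c_one, 𝒢.c_one] at h; rw [h]

theorem exists_compactOpen {x : 𝒢.Obj} {O : Set 𝒢.Obj} (hO : IsOpen O) (hx : x ∈ O) :
    ∃ U, IsCompact U ∧ IsOpen U ∧ x ∈ U ∧ U ⊆ O := by
  obtain ⟨B, ⟨hBc, hBo, -, -⟩, hxB, hBO⟩ :=
    (IsAmple.isTopologicalBasis (𝒢 := 𝒢)).exists_subset_of_mem_open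
      (Set.mem_image_of_mem 𝒢.one hx) (𝒢.isOpenEmbedding_one.isOpenMap _ hO)
  refine ⟨𝒢.one ⁻¹' B, ?_, hBo.preimage 𝒢.isEmbedding_one.continuous, hxB, ?_⟩
  · refine 𝒢.isEmbedding_one.isCompact_preimage_iff ?_ |>.2 hBc
    exact hBO.trans (Set.image_subset_range _ _)
  · intro y hy
    obtain ⟨z, hz, hzy⟩ := hBO hy
    rwa [← 𝒢.isEmbedding_one.injective hzy]

theorem exists_compactOpen_superset {K : Set 𝒢.Obj} (hK : IsCompact K) :
    ∃ U, IsCompact U ∧ IsOpen U ∧ K ⊆ U := by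
  refine hK.induction_on (p := fun K => ∃ U, IsCompact U ∧ IsOpen U ∧ K ⊆ U)
    ⟨∅, isCompact_empty, isOpen_empty, subset_rfl⟩ ?_ ?_ ?_
  · rintro s t' hst ⟨U, h1, h2, h3⟩; exact ⟨U, h1, h2, hst.trans h3⟩
  · rintro s t' ⟨U, h1, h2, h3⟩ ⟨V, h4, h5, h6⟩
    exact ⟨U ∪ V, h1.union h4, h2.union h5, Set.union_subset_union h3 h6⟩
  · intro x _
    obtain ⟨U, h1, h2, h3, -⟩ := exists_compactOpen (𝒢 := 𝒢) isOpen_univ (Set.mem_univ x)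
    exact ⟨U, mem_nhdsWithin_of_mem_nhds (h2.mem_nhds h3), U, h1, h2, subset_rfl⟩

theorem setMul_mem {B C : Set 𝒢.Arr} (hB : B ∈ 𝒢.compactOpenBisections)
    (hC : C ∈ 𝒢.compactOpenBisections) : setMul B C ∈ 𝒢.compactOpenBisections := by
  obtain ⟨hBc, hBo, hBd, hBr⟩ := hB
  obtain ⟨hCc, hCo, hCd, hCr⟩ := hC
  refine ⟨?_, ?_, ?_, ?_⟩
  · have hcl : IsClosed {p : 𝒢.Arr × 𝒢.Arr | 𝒢.d p.1 = 𝒢.c p.2} :=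
      isClosed_eq (𝒢.continuous_d.comp continuous_fst) (𝒢.continuous_c.comp continuous_snd)
    have hcomp : IsCompact ((Subtype.val : {p : 𝒢.Arr × 𝒢.Arr // 𝒢.d p.1 = 𝒢.c p.2} → _) ⁻¹'
        (B ×ˢ C)) :=
      hcl.isClosedEmbedding_subtypeVal.isCompact_preimage (hBc.prod hCc)
    convert hcomp.image 𝒢.continuous_comp using 1
    ext g
    constructor
    · rintro ⟨b, hb, k, hk, e, rfl⟩
      exact ⟨⟨(b, k), e⟩, ⟨hb, hk⟩, rfl⟩
    · rintro ⟨⟨⟨b, k⟩, e⟩, ⟨hb, hk⟩, rfl⟩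
      exact ⟨b, hb, k, hk, e, rfl⟩
  · rw [isOpen_iff_mem_nhds]
    rintro _ ⟨b, hb, k, hk, e, rfl⟩
    have hd := IsAmple.isLocalHomeomorph_d (𝒢 := 𝒢)
    let P := {p : 𝒢.Arr × 𝒢.Arr // 𝒢.d p.1 = 𝒢.d p.2}
    let F : P → 𝒢.Arr := fun p =>
      𝒢.comp p.1.1 (𝒢.inv p.1.2) (p.2.trans (𝒢.c_inv _).symm)
    have hF : Continuous F := 𝒢.continuous_comp.comp
      (f := fun p : P => (⟨(p.1.1, 𝒢.inv p.1.2), p.2.trans (𝒢.c_inv _).symm⟩ :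
        {p : 𝒢.Arr × 𝒢.Arr // 𝒢.d p.1 = 𝒢.c p.2}))
      (((continuous_fst.comp continuous_subtype_val).prodMk
        (𝒢.continuous_inv.comp (continuous_snd.comp continuous_subtype_val))).subtype_mk _)
    let p₀ : P := ⟨(𝒢.comp b k e, k), 𝒢.d_comp _ _ _⟩
    have hp₀ : F p₀ = b := comp_comp_inv b k e
    have hnh : F ⁻¹' B ∈ 𝓝 p₀ := (hBo.preimage hF).mem_nhds (by simpa [hp₀] using hb)
    rw [nhds_subtype_eq_comap, Filter.mem_comap] at hnh
    obtain ⟨W, hW, hWB⟩ := hnh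
    rw [nhds_prod_eq, Filter.mem_prod_iff] at hW
    obtain ⟨W₁, hW₁, W₂, hW₂, hW12⟩ := hW
    have h2 : 𝒢.d '' (W₂ ∩ C) ∈ 𝓝 (𝒢.d (𝒢.comp b k e)) := by
      rw [𝒢.d_comp, ← hd.map_nhds_eq]
      exact Filter.image_mem_map (Filter.inter_mem hW₂ (hCo.mem_nhds hk))
    filter_upwards [hW₁, 𝒢.continuous_d.continuousAt.preimage_mem_nhds h2] with g hg hg'
    obtain ⟨k', ⟨hk'W, hk'C⟩, hk'⟩ := hg'
    have : F ⟨(g, k'), hk'.symm⟩ ∈ B := hWB (hW12 (Set.mk_mem_prod hg hk'W))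
    exact ⟨_, this, k', hk'C, _, comp_inv_comp g k' hk'.symm⟩
  · rintro _ ⟨b, hb, k, hk, e, rfl⟩ _ ⟨b', hb', k', hk', e', rfl⟩ h
    rw [𝒢.d_comp, 𝒢.d_comp] at h
    have h1 := hCd hk hk' h
    subst h1
    have h2 := hBd hb hb' (e.trans e'.symm)
    subst h2; rfl
  · rintro _ ⟨b, hb, k, hk, e, rfl⟩ _ ⟨b', hb', k', hk', e', rfl⟩ h
    rw [𝒢.c_comp, 𝒢.c_comp] at h
    have h1 := hBr hb hb' h
    subst h1
    have h2 := hCr hk hk' (e.symm.trans e')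
    subst h2; rfl

end Ample

theorem setMul_assoc (B C D : Set 𝒢.Arr) :
    setMul (setMul B C) D = setMul B (setMul C D) := by
  ext g
  constructor
  · rintro ⟨_, ⟨b, hb, k, hk, e, rfl⟩, l, hl, e', rfl⟩
    have e'' : 𝒢.d k = 𝒢.c l := by rw [← e', 𝒢.d_comp]
    exact ⟨b, hb, _, ⟨k, hk, l, hl, e'', rfl⟩, _, (𝒢.comp_assoc b k l e e'').symm⟩
  · rintro ⟨b, hb, _, ⟨k, hk, l, hl, e'', rfl⟩, e', rfl⟩
    have e : 𝒢.d b = 𝒢.c k := by rw [e', 𝒢.c_comp]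
    exact ⟨_, ⟨b, hb, k, hk, e, rfl⟩, l, hl, _, 𝒢.comp_assoc b k l e e''⟩

theorem setMul_units (B : Set 𝒢.Arr) (U : Set 𝒢.Obj) :
    setMul B (units U) = B ∩ 𝒢.d ⁻¹' U := by
  ext g
  constructor
  · rintro ⟨b, hb, _, ⟨x, hx, rfl⟩, e, rfl⟩
    rw [comp_one']
    refine ⟨hb, ?_⟩
    rw [𝒢.c_one] at e
    simpa [e] using hx
  · rintro ⟨hg, hU⟩
    exact ⟨g, hg, _, ⟨𝒢.d g, hU, rfl⟩, (𝒢.c_one _).symm, 𝒢.comp_one g⟩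

theorem units_setMul (B : Set 𝒢.Arr) (U : Set 𝒢.Obj) :
    setMul (units U) B = B ∩ 𝒢.c ⁻¹' U := by
  ext g
  constructor
  · rintro ⟨_, ⟨x, hx, rfl⟩, b, hb, e, rfl⟩
    rw [one_comp']
    refine ⟨hb, ?_⟩
    rw [𝒢.d_one] at e
    simpa [← e] using hx
  · rintro ⟨hg, hU⟩
    exact ⟨_, ⟨𝒢.c g, hU, rfl⟩, g, hg, 𝒢.d_one _, 𝒢.one_comp g⟩

end TopGroupoid

open TopGroupoid

/-! ### Steinberg algebras -/

namespace TopGroupoid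

section FiberSums

variable {𝒢 : TopGroupoid.{u}} {R : Type v} [CommRing R]

/-- The characteristic function `1_B : 𝒢 → R`. -/
noncomputable def charFun (R : Type v) [CommRing R] (B : Set 𝒢.Arr) : 𝒢.Arr → R :=
  B.indicator 1

/-- The sum `∑ f(g) F(g)` over the arrows `g` with `d g = x`. -/
noncomputable def fiberSum {N : Type*} [AddCommGroup N] [Module R N] (x : 𝒢.Obj) (f : 𝒢.Arr → R)
    (F : {g : 𝒢.Arr // 𝒢.d g = x} → N) : N :=
  ∑ᶠ g, f g.1 • F g

/-- `f` has finite support on each fibre of `d`. -/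
def FiberFinite (f : 𝒢.Arr → R) : Prop :=
  ∀ x, (Function.support fun g : {g : 𝒢.Arr // 𝒢.d g = x} => f g.1).Finite

variable {N : Type*} [AddCommGroup N] [Module R N]

theorem FiberFinite.support {f : 𝒢.Arr → R} (hf : FiberFinite f) (x : 𝒢.Obj)
    (F : {g : 𝒢.Arr // 𝒢.d g = x} → N) : (Function.support fun g => f g.1 • F g).Finite := by
  refine (hf x).subset fun g hg h => hg ?_
  have h' : f g.1 = 0 := h
  simp [h']

theorem fiberSum_add_left {f f' : 𝒢.Arr → R} (hf : FiberFinite f) (hf' : FiberFinite f')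
    (x : 𝒢.Obj) (F : {g : 𝒢.Arr // 𝒢.d g = x} → N) :
    fiberSum x (f + f') F = fiberSum x f F + fiberSum x f' F := by
  unfold fiberSum
  rw [← finsum_add_distrib (hf.support x F) (hf'.support x F)]
  simp [add_smul]

theorem fiberSum_add_right {f : 𝒢.Arr → R} (hf : FiberFinite f)
    (x : 𝒢.Obj) (F F' : {g : 𝒢.Arr // 𝒢.d g = x} → N) :
    fiberSum x f (fun g => F g + F' g) = fiberSum x f F + fiberSum x f F' := by
  unfold fiberSum
  rw [← finsum_add_distrib (hf.support x F) (hf.support x F')]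
  simp [smul_add]

theorem map_fiberSum {N' : Type*} [AddCommGroup N'] [Module R N'] {f : 𝒢.Arr → R}
    (hf : FiberFinite f) (x : 𝒢.Obj) (F : {g : 𝒢.Arr // 𝒢.d g = x} → N) (φ : N →ₗ[R] N') :
    φ (fiberSum x f F) = fiberSum x f (fun g => φ (F g)) := by
  unfold fiberSum
  rw [← LinearMap.toAddMonoidHom_coe, AddMonoidHom.map_finsum _ (hf.support x F)]
  simp

theorem fiberSum_smul_right {f : 𝒢.Arr → R} (hf : FiberFinite f) (r : R)
    (x : 𝒢.Obj) (F : {g : 𝒢.Arr // 𝒢.d g = x} → N) :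
    fiberSum x f (fun g => r • F g) = r • fiberSum x f F :=
  (map_fiberSum hf x F (LinearMap.lsmul R N r)).symm

theorem fiberSum_smul_left {f : 𝒢.Arr → R} (hf : FiberFinite f) (r : R)
    (x : 𝒢.Obj) (F : {g : 𝒢.Arr // 𝒢.d g = x} → N) :
    fiberSum x (r • f) F = r • fiberSum x f F := by
  rw [← fiberSum_smul_right hf]
  unfold fiberSum
  exact finsum_congr fun g => by simp [mul_smul, smul_comm r (f g.1)]

theorem fiberSum_charFun_of_mem {B : Set 𝒢.Arr} (hB : Set.InjOn 𝒢.d B) {x : 𝒢.Obj}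
    (F : {g : 𝒢.Arr // 𝒢.d g = x} → N) {b : 𝒢.Arr} (hb : b ∈ B) (hx : 𝒢.d b = x) :
    fiberSum x (charFun R B) F = F ⟨b, hx⟩ := by
  unfold fiberSum
  rw [finsum_eq_single _ ⟨b, hx⟩]
  · simp [charFun, hb]
  · rintro ⟨g, hg⟩ hne
    have : g ∉ B := fun h => hne (Subtype.ext (hB h hb (hg.trans hx.symm)))
    simp [charFun, this]

theorem fiberSum_charFun_of_notMem {B : Set 𝒢.Arr} {x : 𝒢.Obj}
    (F : {g : 𝒢.Arr // 𝒢.d g = x} → N) (hx : x ∉ 𝒢.d '' B) :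
    fiberSum x (charFun R B) F = 0 := by
  unfold fiberSum
  rw [finsum_eq_zero_of_forall_eq_zero]
  rintro ⟨g, hg⟩
  have : g ∉ B := fun h => hx ⟨g, h, hg⟩
  simp [charFun, this]

theorem fiberFinite_charFun {B : Set 𝒢.Arr} (hB : Set.InjOn 𝒢.d B) :
    FiberFinite (charFun R B) := by
  intro x
  refine Set.Subsingleton.finite ?_
  rintro ⟨g, hg⟩ h ⟨g', hg'⟩ h'
  have h1 : g ∈ B := by by_contra hn; exact h (by simp [charFun, hn])
  have h2 : g' ∈ B := by by_contra hn; exact h' (by simp [charFun, hn])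
  exact Subtype.ext (hB h1 h2 (hg.trans hg'.symm))

theorem FiberFinite.add {f f' : 𝒢.Arr → R} (hf : FiberFinite f) (hf' : FiberFinite f') :
    FiberFinite (f + f') := fun x =>
  ((hf x).union (hf' x)).subset (Function.support_add _ _)

theorem FiberFinite.smul {f : 𝒢.Arr → R} (hf : FiberFinite f) (r : R) :
    FiberFinite (r • f) := fun x =>
  (hf x).subset fun g hg h => hg (by
    have h' : f g.1 = 0 := h
    simp [h'])

/-- The convolution `(f * f')(x) = ∑ f(x y⁻¹) f'(y)`, the sum being over the arrows `y` with
`d y = d x`. -/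
noncomputable def conv (f f' : 𝒢.Arr → R) (x : 𝒢.Arr) : R :=
  ∑ᶠ y : {y : 𝒢.Arr // 𝒢.d y = 𝒢.d x},
    f (𝒢.comp x (𝒢.inv y.1) (y.2.symm.trans (𝒢.c_inv y.1).symm)) * f' y.1

theorem conv_eq_fiberSum (f f' : 𝒢.Arr → R) (x : 𝒢.Arr) :
    conv f f' x = fiberSum (𝒢.d x) f' fun y =>
      f (𝒢.comp x (𝒢.inv y.1) (y.2.symm.trans (𝒢.c_inv y.1).symm)) :=
  finsum_congr fun y => by rw [smul_eq_mul, mul_comm]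

theorem conv_charFun (B : Set 𝒢.Arr) {C : Set 𝒢.Arr} (hC : Set.InjOn 𝒢.d C) :
    conv (charFun R B) (charFun R C) = charFun R (setMul B C) := by
  funext x
  rw [conv_eq_fiberSum]
  by_cases hx : 𝒢.d x ∈ 𝒢.d '' C
  · obtain ⟨k, hk, hkx⟩ := hx
    rw [fiberSum_charFun_of_mem hC _ hk hkx]
    have e : 𝒢.d x = 𝒢.c (𝒢.inv k) := hkx.symm.trans (𝒢.c_inv k).symm
    have : x ∈ setMul B C ↔ 𝒢.comp x (𝒢.inv k) e ∈ B := by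
      constructor
      · rintro ⟨b, hb, k', hk', e', rfl⟩
        have : k' = k := hC hk' hk (by rw [hkx, 𝒢.d_comp])
        subst this
        rwa [comp_comp_inv b k' e']
      · intro h
        exact ⟨_, h, k, hk, _, comp_inv_comp x k hkx.symm⟩
    classical
    simp only [charFun, Set.indicator_apply, this, Pi.one_apply]
  · rw [fiberSum_charFun_of_notMem _ hx]
    have : x ∉ setMul B C := by
      rintro ⟨b, hb, k, hk, e, rfl⟩
      exact hx ⟨k, hk, (𝒢.d_comp _ _ _).symm⟩
    simp [charFun, this]

end FiberSums

variable (R : Type v) [CommRing R] (𝒢 : TopGroupoid.{u})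

/-- The `R`-submodule of `R^𝒢` generated by the functions `1_B`, for `B` a compact open bisection. -/
def steinbergSubmodule : Submodule R (𝒢.Arr → R) :=
  Submodule.span R (charFun R '' 𝒢.compactOpenBisections)

/-- The Steinberg algebra `A_R(𝒢)`, as a type. -/
def SteinbergAlgebra : Type (max u v) := steinbergSubmodule R 𝒢

namespace SteinbergAlgebra

noncomputable instance instAddCommGroup : AddCommGroup (SteinbergAlgebra R 𝒢) :=
  inferInstanceAs (AddCommGroup (steinbergSubmodule R 𝒢))

noncomputable instance instModule : Module R (SteinbergAlgebra R 𝒢) :=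
  inferInstanceAs (Module R (steinbergSubmodule R 𝒢))

variable {R 𝒢}

/-- The underlying function of an element of the Steinberg algebra. -/
def toFun (f : SteinbergAlgebra R 𝒢) : 𝒢.Arr → R := f.1

@[ext] theorem ext {f f' : SteinbergAlgebra R 𝒢} (h : f.toFun = f'.toFun) : f = f' :=
  Subtype.ext h

@[simp] theorem toFun_add (f f' : SteinbergAlgebra R 𝒢) :
    (f + f').toFun = f.toFun + f'.toFun := rfl

@[simp] theorem toFun_smul (r : R) (f : SteinbergAlgebra R 𝒢) :
    (r • f).toFun = r • f.toFun := rfl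

@[simp] theorem toFun_zero : (0 : SteinbergAlgebra R 𝒢).toFun = 0 := rfl

/-- The element `1_B` of the Steinberg algebra. -/
noncomputable def char (B : Set 𝒢.Arr) (hB : B ∈ 𝒢.compactOpenBisections) :
    SteinbergAlgebra R 𝒢 :=
  ⟨charFun R B, Submodule.subset_span ⟨B, hB, rfl⟩⟩

theorem char_congr {B C : Set 𝒢.Arr} (h : B = C) (hB : B ∈ 𝒢.compactOpenBisections)
    (hC : C ∈ 𝒢.compactOpenBisections) :
    (char B hB : SteinbergAlgebra R 𝒢) = char C hC := by
  subst h; rfl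

theorem induction {P : SteinbergAlgebra R 𝒢 → Prop}
    (char : ∀ B hB, P (char B hB)) (add : ∀ f f', P f → P f' → P (f + f'))
    (smul : ∀ (r : R) f, P f → P (r • f)) (f : SteinbergAlgebra R 𝒢) : P f := by
  obtain ⟨f, hf⟩ := f
  refine Submodule.span_induction (p := fun f hf => P ⟨f, hf⟩) ?_ ?_ ?_ ?_ hf
  · rintro _ ⟨B, hB, rfl⟩; exact char B hB
  · have : (0 : SteinbergAlgebra R 𝒢) = (0 : R) • SteinbergAlgebra.char ∅
        ⟨isCompact_empty, isOpen_empty, Set.injOn_empty _, Set.injOn_empty _⟩ := by simp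
    have h := smul 0 _ (char ∅ ⟨isCompact_empty, isOpen_empty, Set.injOn_empty _, Set.injOn_empty _⟩)
    rw [← this] at h
    exact h
  · intro f f' hf hf' h h'; exact add _ _ h h'
  · intro r f hf h; exact smul r _ h

theorem fiberFinite (f : SteinbergAlgebra R 𝒢) : FiberFinite f.toFun :=
  induction (P := fun f => FiberFinite f.toFun) (fun _ hB => fiberFinite_charFun hB.2.2.1)
    (fun _ _ h h' => h.add h') (fun r _ h => h.smul r) f

theorem conv_add_left (f f' g : SteinbergAlgebra R 𝒢) :
    conv (f.toFun + f'.toFun) g.toFun = conv f.toFun g.toFun + conv f'.toFun g.toFun := by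
  funext x
  simp only [conv_eq_fiberSum, Pi.add_apply]
  exact fiberSum_add_right g.fiberFinite _ _ _

theorem conv_add_right (f g g' : SteinbergAlgebra R 𝒢) :
    conv f.toFun (g.toFun + g'.toFun) = conv f.toFun g.toFun + conv f.toFun g'.toFun := by
  funext x
  simp only [conv_eq_fiberSum, Pi.add_apply]
  exact fiberSum_add_left g.fiberFinite g'.fiberFinite _ _

theorem conv_smul_left (r : R) (f g : SteinbergAlgebra R 𝒢) :
    conv (r • f.toFun) g.toFun = r • conv f.toFun g.toFun := by
  funext x
  simp only [conv_eq_fiberSum, Pi.smul_apply]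
  exact fiberSum_smul_right g.fiberFinite _ _ _

theorem conv_smul_right (r : R) (f g : SteinbergAlgebra R 𝒢) :
    conv f.toFun (r • g.toFun) = r • conv f.toFun g.toFun := by
  funext x
  simp only [conv_eq_fiberSum, Pi.smul_apply]
  exact fiberSum_smul_left g.fiberFinite _ _ _

variable [𝒢.IsAmple]

theorem conv_mem (f g : SteinbergAlgebra R 𝒢) :
    conv f.toFun g.toFun ∈ steinbergSubmodule R 𝒢 := by
  refine induction (P := fun f => conv f.toFun g.toFun ∈ steinbergSubmodule R 𝒢) ?_ ?_ ?_ f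
  · intro B hB
    refine induction
      (P := fun g => conv (char B hB).toFun g.toFun ∈ steinbergSubmodule R 𝒢) ?_ ?_ ?_ g
    · intro C hC
      have : conv (char B hB : SteinbergAlgebra R 𝒢).toFun (char C hC).toFun
          = charFun R (setMul B C) := conv_charFun B hC.2.2.1
      rw [this]
      exact Submodule.subset_span ⟨_, setMul_mem hB hC, rfl⟩
    · intro g g' h h'
      rw [toFun_add, conv_add_right]; exact add_mem h h'
    · intro r g h
      rw [toFun_smul, conv_smul_right]; exact Submodule.smul_mem _ _ h
  · intro f f' h h'
    rw [toFun_add, conv_add_left]; exact add_mem h h'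
  · intro r f h
    rw [toFun_smul, conv_smul_left]; exact Submodule.smul_mem _ _ h

noncomputable instance instMul : Mul (SteinbergAlgebra R 𝒢) :=
  ⟨fun f g => ⟨conv f.toFun g.toFun, conv_mem f g⟩⟩

theorem toFun_mul (f g : SteinbergAlgebra R 𝒢) : (f * g).toFun = conv f.toFun g.toFun := rfl

theorem add_mul' (f f' g : SteinbergAlgebra R 𝒢) : (f + f') * g = f * g + f' * g :=
  ext (conv_add_left f f' g)

theorem mul_add' (f g g' : SteinbergAlgebra R 𝒢) : f * (g + g') = f * g + f * g' :=
  ext (conv_add_right f g g')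

theorem smul_mul_left' (r : R) (f g : SteinbergAlgebra R 𝒢) : r • f * g = r • (f * g) :=
  ext (conv_smul_left r f g)

theorem mul_smul_right' (r : R) (f g : SteinbergAlgebra R 𝒢) : f * r • g = r • (f * g) :=
  ext (conv_smul_right r f g)

theorem char_mul_char {B C : Set 𝒢.Arr} (hB : B ∈ 𝒢.compactOpenBisections)
    (hC : C ∈ 𝒢.compactOpenBisections) :
    (char B hB * char C hC : SteinbergAlgebra R 𝒢) = char (setMul B C) (setMul_mem hB hC) :=
  ext (conv_charFun B hC.2.2.1)

theorem mul_assoc' (f g h : SteinbergAlgebra R 𝒢) : f * g * h = f * (g * h) := by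
  induction f using induction with
  | add f f' h1 h2 => simp only [add_mul', h1, h2]
  | smul r f h1 => simp only [smul_mul_left', h1]
  | char B hB =>
    induction g using induction with
    | add f f' h1 h2 => simp only [add_mul', mul_add', h1, h2]
    | smul r f h1 => simp only [smul_mul_left', mul_smul_right', h1]
    | char C hC =>
      induction h using induction with
      | add f f' h1 h2 => simp only [mul_add', h1, h2]
      | smul r f h1 => simp only [mul_smul_right', h1]
      | char D hD =>
        simp only [char_mul_char]
        exact char_congr (setMul_assoc B C D) _ _

noncomputable instance instNonUnitalRing : NonUnitalRing (SteinbergAlgebra R 𝒢) :=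
  { (inferInstance : AddCommGroup (SteinbergAlgebra R 𝒢)),
    (inferInstance : Mul (SteinbergAlgebra R 𝒢)) with
    left_distrib := mul_add'
    right_distrib := add_mul'
    zero_mul := fun f => by
      have := smul_mul_left' (0 : R) (0 : SteinbergAlgebra R 𝒢) f
      rwa [zero_smul, zero_smul] at this
    mul_zero := fun f => by
      have := mul_smul_right' (0 : R) f (0 : SteinbergAlgebra R 𝒢)
      rwa [zero_smul, zero_smul] at this
    mul_assoc := mul_assoc' }

/-- The element `1_U`, for `U` a compact open set of units. -/
noncomputable def charUnits (U : Set 𝒢.Obj) (hc : IsCompact U) (ho : IsOpen U) :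
    SteinbergAlgebra R 𝒢 :=
  char (units U) (units_mem hc ho)

theorem char_mul_charUnits {B : Set 𝒢.Arr} (hB : B ∈ 𝒢.compactOpenBisections) {U : Set 𝒢.Obj}
    (hc : IsCompact U) (ho : IsOpen U) (hBU : 𝒢.d '' B ⊆ U) :
    (char B hB * charUnits U hc ho : SteinbergAlgebra R 𝒢) = char B hB := by
  rw [charUnits, char_mul_char]
  refine char_congr ?_ _ _
  rw [setMul_units]
  exact Set.inter_eq_left.2 fun b hb => hBU ⟨b, hb, rfl⟩

theorem charUnits_mul_of_subset {U V : Set 𝒢.Obj} (hc : IsCompact U) (ho : IsOpen U)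
    (hc' : IsCompact V) (ho' : IsOpen V) (h : U ⊆ V) :
    (charUnits U hc ho * charUnits V hc' ho' : SteinbergAlgebra R 𝒢) = charUnits U hc ho := by
  refine char_mul_charUnits _ _ _ ?_
  rintro _ ⟨_, ⟨x, hx, rfl⟩, rfl⟩
  rw [𝒢.d_one]; exact h hx

theorem charUnits_mul_charUnits {U V : Set 𝒢.Obj} (hc : IsCompact U) (ho : IsOpen U)
    (hc' : IsCompact V) (ho' : IsOpen V) :
    (charUnits U hc ho * charUnits V hc' ho' : SteinbergAlgebra R 𝒢) =
      charUnits (U ∩ V) (hc.inter hc') (ho.inter ho') := by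
  rw [charUnits, charUnits, char_mul_char]
  refine char_congr ?_ _ _
  rw [setMul_units]
  ext g
  constructor
  · rintro ⟨⟨x, hx, rfl⟩, h⟩
    rw [Set.mem_preimage, 𝒢.d_one] at h
    exact ⟨x, ⟨hx, h⟩, rfl⟩
  · rintro ⟨x, ⟨hx, h⟩, rfl⟩
    exact ⟨⟨x, hx, rfl⟩, by rwa [Set.mem_preimage, 𝒢.d_one]⟩

theorem exists_mul_charUnits (f : SteinbergAlgebra R 𝒢) :
    ∃ U, ∃ hc : IsCompact U, ∃ ho : IsOpen U, f * charUnits U hc ho = f := by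
  induction f using induction with
  | char B hB =>
    have hd := IsAmple.isLocalHomeomorph_d (𝒢 := 𝒢)
    exact ⟨𝒢.d '' B, hB.1.image 𝒢.continuous_d, hd.isOpenMap _ hB.2.1,
      char_mul_charUnits hB _ _ subset_rfl⟩
  | smul r f h =>
    obtain ⟨U, hc, ho, h⟩ := h
    exact ⟨U, hc, ho, by rw [smul_mul_left', h]⟩
  | add f f' h h' =>
    obtain ⟨U, hc, ho, h⟩ := h
    obtain ⟨V, hc', ho', h'⟩ := h'
    refine ⟨U ∪ V, hc.union hc', ho.union ho', ?_⟩
    rw [add_mul, ← h, ← h', mul_assoc, mul_assoc,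
      charUnits_mul_of_subset _ _ _ _ Set.subset_union_left,
      charUnits_mul_of_subset _ _ _ _ Set.subset_union_right]

theorem exists_mul_charUnits₂ (f g : SteinbergAlgebra R 𝒢) :
    ∃ U, ∃ hc : IsCompact U, ∃ ho : IsOpen U,
      f * charUnits U hc ho = f ∧ g * charUnits U hc ho = g := by
  obtain ⟨U, hc, ho, h⟩ := exists_mul_charUnits f
  obtain ⟨V, hc', ho', h'⟩ := exists_mul_charUnits g
  refine ⟨U ∪ V, hc.union hc', ho.union ho', ?_, ?_⟩
  · rw [← h, mul_assoc, charUnits_mul_of_subset _ _ _ _ Set.subset_union_left]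
  · rw [← h', mul_assoc, charUnits_mul_of_subset _ _ _ _ Set.subset_union_right]

/-- The homogeneous component `A_R(𝒢)_γ`: the elements supported in the component of degree `γ`. -/
def component {Γ : Type t} [Group Γ] (κ : 𝒢.Grading Γ) (γ : Γ) :
    AddSubgroup (SteinbergAlgebra R 𝒢) where
  carrier := {f | ∀ g, f.toFun g ≠ 0 → κ.deg g = γ}
  zero_mem' := fun g h => absurd rfl h
  add_mem' := by
    intro f f' h h' g hg
    by_cases h0 : f.toFun g = 0
    · refine h' g fun h1 => hg ?_
      simp [h0, h1]
    · exact h g h0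
  neg_mem' := by
    intro f h g hg
    refine h g fun h1 => hg ?_
    have : (-f).toFun g = - f.toFun g := rfl
    rw [this, h1, neg_zero]

end SteinbergAlgebra

end TopGroupoid

/-! ### Internal direct sums -/

namespace GradedDirectSum

open Classical in
/-- The family `N` of subgroups (or submodules) of `M` has `M` as its internal direct sum. -/
def IsDirectSum {Γ : Type*} {M : Type*} {S : Type*} [AddCommMonoid M] [SetLike S M]
    [AddSubmonoidClass S M] (N : Γ → S) : Prop :=
  DirectSum.IsInternal N

variable {Γ : Type*} {M : Type*} {S : Type*} [AddCommGroup M] [SetLike S M]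
    [AddSubmonoidClass S M] {N : Γ → S}

open Classical in
/-- The isomorphism of an internal direct sum with the external one. -/
noncomputable def equiv (h : IsDirectSum N) : (DirectSum Γ fun γ => N γ) ≃+ M :=
  AddEquiv.ofBijective (DirectSum.coeAddMonoidHom N) (by unfold IsDirectSum at h; exact h)

/-- The homogeneous component of degree `γ` of an element. -/
noncomputable def proj (h : IsDirectSum N) (γ : Γ) : M →+ M where
  toFun m := ((equiv h).symm m γ : M)
  map_zero' := by rw [map_zero]; rfl
  map_add' m n := by rw [map_add]; rfl

theorem proj_mem (h : IsDirectSum N) (γ : Γ) (m : M) : proj h γ m ∈ N γ :=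
  SetLike.coe_mem _

theorem exists_sum_proj (h : IsDirectSum N) (m : M) :
    ∃ D : Finset Γ, (∀ γ ∉ D, proj h γ m = 0) ∧ ∑ γ ∈ D, proj h γ m = m := by
  classical
  refine ⟨((equiv h).symm m).support, ?_, ?_⟩
  · intro γ hγ
    have := DFinsupp.notMem_support_iff.1 hγ
    change (((equiv h).symm m γ : N γ) : M) = 0
    rw [this]; rfl
  · have h1 : DirectSum.coeAddMonoidHom N ((equiv h).symm m) = m :=
      (equiv h).apply_symm_apply m
    rw [DirectSum.coeAddMonoidHom_eq_dfinsuppSum] at h1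
    exact h1

open Classical in
theorem equiv_symm_of_mem (h : IsDirectSum N) {γ : Γ} {m : M} (hm : m ∈ N γ) :
    (equiv h).symm m = DirectSum.of (fun γ => N γ) γ ⟨m, hm⟩ := by
  rw [AddEquiv.symm_apply_eq]
  exact (DirectSum.coeAddMonoidHom_of N γ ⟨m, hm⟩).symm

theorem proj_of_mem (h : IsDirectSum N) {γ : Γ} {m : M} (hm : m ∈ N γ) : proj h γ m = m := by
  classical
  change (((equiv h).symm m γ : N γ) : M) = m
  rw [equiv_symm_of_mem h hm, DirectSum.of_eq_same]

theorem proj_of_mem_ne (h : IsDirectSum N) {γ δ : Γ} {m : M} (hm : m ∈ N γ) (hne : γ ≠ δ) :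
    proj h δ m = 0 := by
  classical
  change (((equiv h).symm m δ : N δ) : M) = 0
  rw [equiv_symm_of_mem h hm, DirectSum.of_eq_of_ne _ _ _ hne.symm]; rfl

theorem proj_sum (h : IsDirectSum N) (D : Finset Γ) (m : Γ → M) (hm : ∀ γ ∈ D, m γ ∈ N γ)
    {γ : Γ} : (γ ∈ D → proj h γ (∑ δ ∈ D, m δ) = m γ) ∧
      (γ ∉ D → proj h γ (∑ δ ∈ D, m δ) = 0) := by
  rw [map_sum]
  constructor
  · intro hγ
    rw [Finset.sum_eq_single_of_mem γ hγ fun δ hδ hne => proj_of_mem_ne h (hm δ hδ) hne]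
    exact proj_of_mem h (hm γ hγ)
  · intro hγ
    exact Finset.sum_eq_zero fun δ hδ =>
      proj_of_mem_ne h (hm δ hδ) (fun e => hγ (e ▸ hδ))

theorem isDirectSum_of_proj (π : Γ → M →+ M) (h1 : ∀ γ, ∀ m ∈ N γ, π γ m = m)
    (h2 : ∀ γ δ, γ ≠ δ → ∀ m ∈ N γ, π δ m = 0)
    (h3 : ∀ m, ∃ (D : Finset Γ) (n : Γ → M), (∀ γ, n γ ∈ N γ) ∧ ∑ γ ∈ D, n γ = m) :
    IsDirectSum N := by
  classical
  have key : ∀ (f : DirectSum Γ fun γ => N γ) (γ : Γ),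
      π γ (DirectSum.coeAddMonoidHom N f) = (f γ : M) := by
    intro f γ
    induction f using DirectSum.induction_on with
    | zero => simp
    | of δ m =>
      rw [DirectSum.coeAddMonoidHom_of]
      by_cases hne : δ = γ
      · subst hne; rw [DirectSum.of_eq_same]; exact h1 _ _ m.2
      · rw [DirectSum.of_eq_of_ne _ _ _ (Ne.symm hne)]; exact h2 _ _ hne _ m.2
    | add f g hf hg => rw [map_add, map_add, hf, hg]; rfl
  have : DirectSum.IsInternal N := by
    constructor
    · intro f g hfg
      refine DFinsupp.ext fun γ => Subtype.ext ?_
      have := congrArg (π γ) hfg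
      rwa [key, key] at this
    · intro m
      obtain ⟨D, n, hn, rfl⟩ := h3 m
      refine ⟨∑ γ ∈ D, DirectSum.of (fun γ => N γ) γ ⟨n γ, hn γ⟩, ?_⟩
      rw [map_sum]
      exact Finset.sum_congr rfl fun γ _ => DirectSum.coeAddMonoidHom_of _ _ _
  unfold IsDirectSum
  convert this

end GradedDirectSum

open GradedDirectSum

/-! ### Unital right modules over a ring without unit -/

/-- A unital right module `M` over a (not necessarily unital) ring `A`: `act m a` is `m a`, and
unitality is `M = MA`. -/
structure RightModule (A : Type a) [NonUnitalRing A] : Type (max a (w + 1)) where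
  carrier : Type w
  [addCommGroup : AddCommGroup carrier]
  act : carrier →+ A →+ carrier
  act_act : ∀ m a b, act (act m a) b = act m (a * b)
  unital : AddSubgroup.closure {n | ∃ m a, act m a = n} = ⊤

namespace RightModule

attribute [instance] addCommGroup

variable {A : Type a} [NonUnitalRing A]

/-- A homomorphism of right `A`-modules. -/
@[ext] structure Hom (M N : RightModule.{w, a} A) : Type w where
  map : M.carrier →+ N.carrier
  map_act : ∀ m a, map (M.act m a) = N.act (map m) a

/-- The category `Mod A` of unital right `A`-modules. -/
instance instCategory : Category (RightModule.{w, a} A) where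
  Hom := Hom
  id M := ⟨AddMonoidHom.id _, fun _ _ => rfl⟩
  comp f g := ⟨g.map.comp f.map, fun m a => by simp [f.map_act, g.map_act]⟩

end RightModule

/-- A `Γ`-graded unital right module over a ring `A` with homogeneous components `𝒜 γ`. -/
structure GradedRightModule {A : Type a} [NonUnitalRing A] {Γ : Type t} [Group Γ]
    (𝒜 : Γ → AddSubgroup A) : Type (max a t (w + 1)) where
  toModule : RightModule.{w, a} A
  component : Γ → AddSubgroup toModule.carrier
  isDirectSum : IsDirectSum component
  act_mem : ∀ γ δ, ∀ m ∈ component γ, ∀ a ∈ 𝒜 δ, toModule.act m a ∈ component (γ * δ)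

namespace GradedRightModule

variable {A : Type a} [NonUnitalRing A] {Γ : Type t} [Group Γ] {𝒜 : Γ → AddSubgroup A}

/-- A graded homomorphism of graded right `A`-modules. -/
@[ext] structure Hom (M N : GradedRightModule.{w} 𝒜) : Type w where
  hom : M.toModule ⟶ N.toModule
  map_mem : ∀ γ, ∀ m ∈ M.component γ, hom.map m ∈ N.component γ

/-- The category `Gr A` of graded unital right `A`-modules. -/
instance instCategory : Category (GradedRightModule.{w} 𝒜) where
  Hom := Hom
  id M := ⟨𝟙 _, fun _ _ h => h⟩
  comp f g := ⟨f.hom ≫ g.hom, fun γ m h => g.map_mem γ _ (f.map_mem γ m h)⟩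

/-- The functor forgetting the grading. -/
def forget (𝒜 : Γ → AddSubgroup A) : GradedRightModule.{w} 𝒜 ⥤ RightModule.{w, a} A where
  obj M := M.toModule
  map f := f.hom

theorem isDirectSum_shift {M : Type*} [AddCommGroup M] {S : Type*} [SetLike S M]
    [AddSubmonoidClass S M] {N : Γ → S} (h : IsDirectSum N) (α : Γ) :
    IsDirectSum fun γ => N (α * γ) := by
  classical
  refine isDirectSum_of_proj (fun γ => proj h (α * γ)) (fun γ m hm => proj_of_mem h hm)
    (fun γ δ hne m hm => proj_of_mem_ne h hm fun e => hne (mul_left_cancel e)) fun m => ?_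
  obtain ⟨D, -, hD⟩ := exists_sum_proj h m
  refine ⟨D.image fun γ => α⁻¹ * γ, fun γ => proj h (α * γ) m, fun γ => proj_mem h _ _, ?_⟩
  rw [Finset.sum_image fun x _ y _ e => mul_left_cancel e]
  simpa using hD

/-- The shifted module `M(α)`, with `M(α)_γ = M_{αγ}`. -/
def shiftObj (α : Γ) (M : GradedRightModule.{w} 𝒜) : GradedRightModule.{w} 𝒜 where
  toModule := M.toModule
  component γ := M.component (α * γ)
  isDirectSum := isDirectSum_shift M.isDirectSum α
  act_mem γ δ m hm a ha := mul_assoc α γ δ ▸ M.act_mem (α * γ) δ m hm a ha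

/-- The shift functor `𝒯_α : M ↦ M(α)`. -/
def shift (𝒜 : Γ → AddSubgroup A) (α : Γ) :
    GradedRightModule.{w} 𝒜 ⥤ GradedRightModule.{w} 𝒜 where
  obj := shiftObj α
  map f := ⟨f.hom, fun γ m h => f.map_mem (α * γ) m h⟩

end GradedRightModule

/-! ### Sheaves of modules on a groupoid -/

section Sheaves

variable (R : Type v) [CommRing R] (𝒢 : TopGroupoid.{u})

/-- A (right) `𝒢`-sheaf of `R`-modules `E`. The stalks `E_x` are `R`-modules, the sheaf space is
their disjoint union `Σ x, E_x`, with a topology for which the projection `p` to the unit space is a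
local homeomorphism and the module operations are continuous (the fibre product `E ×_{𝒢⁰} E`
is `Σ x, E_x × E_x` with the topology coming from its two projections to `E`). An arrow `g` from
`y = d g` to `x = c g` acts by an `R`-linear map `act g : E_x → E_y`, `e ↦ eg`, and the action
`E ×_{𝒢⁰} 𝒢 → E` is continuous. -/
structure GSheaf : Type (max u v (w + 1)) where
  stalk : 𝒢.Obj → Type w
  [addCommGroup : ∀ x, AddCommGroup (stalk x)]
  [module : ∀ x, Module R (stalk x)]
  [top : TopologicalSpace (Σ x, stalk x)]
  isLocalHomeomorph_proj : IsLocalHomeomorph (Sigma.fst : (Σ x, stalk x) → 𝒢.Obj)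
  continuous_zero : Continuous fun x => (⟨x, 0⟩ : Σ x, stalk x)
  continuous_add :
    @Continuous (Σ x, stalk x × stalk x) (Σ x, stalk x)
      (top.induced (fun q => ⟨q.1, q.2.1⟩) ⊓ top.induced (fun q => ⟨q.1, q.2.2⟩)) top
      (fun q => ⟨q.1, q.2.1 + q.2.2⟩)
  continuous_smul : ∀ r : R, Continuous fun e : Σ x, stalk x => (⟨e.1, r • e.2⟩ : Σ x, stalk x)
  act : ∀ (g : 𝒢.Arr) {x y : 𝒢.Obj}, 𝒢.c g = x → 𝒢.d g = y → stalk x →ₗ[R] stalk y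
  continuous_act : Continuous fun q : {q : (Σ x, stalk x) × 𝒢.Arr // q.1.1 = 𝒢.c q.2} =>
    (⟨𝒢.d q.1.2, act q.1.2 q.2.symm rfl q.1.1.2⟩ : Σ x, stalk x)
  act_one : ∀ x (e : stalk x), act (𝒢.one x) (𝒢.c_one x) (𝒢.d_one x) e = e
  act_act : ∀ (g h : 𝒢.Arr) {x y z : 𝒢.Obj} (hx : 𝒢.c g = x) (hy : 𝒢.d g = y) (hy' : 𝒢.c h = y)
    (hz : 𝒢.d h = z) (e : stalk x), act h hy' hz (act g hx hy e) =
      act (𝒢.comp g h (hy.trans hy'.symm)) ((𝒢.c_comp g h _).trans hx)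
        ((𝒢.d_comp g h _).trans hz) e

namespace GSheaf

attribute [instance] addCommGroup module top

variable {R 𝒢}

/-- The sheaf space of a `𝒢`-sheaf. -/
abbrev Total (E : GSheaf.{u, v, w} R 𝒢) : Type (max u w) := Σ x, E.stalk x

/-- A morphism of `𝒢`-sheaves of `R`-modules. -/
@[ext] structure Hom (E F : GSheaf.{u, v, w} R 𝒢) : Type (max u w) where
  map : ∀ x, E.stalk x →ₗ[R] F.stalk x
  continuous_map : Continuous fun e : E.Total => (⟨e.1, map e.1 e.2⟩ : F.Total)
  map_act : ∀ (g : 𝒢.Arr) {x y : 𝒢.Obj} (hx : 𝒢.c g = x) (hy : 𝒢.d g = y) (e : E.stalk x),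
    map y (E.act g hx hy e) = F.act g hx hy (map x e)

/-- The category `Mod_R 𝒢` of `𝒢`-sheaves of `R`-modules. -/
instance instCategory : Category (GSheaf.{u, v, w} R 𝒢) where
  Hom := Hom
  id E := ⟨fun _ => LinearMap.id, continuous_id, fun _ _ _ _ _ _ => rfl⟩
  comp f g := ⟨fun x => g.map x ∘ₗ f.map x, g.continuous_map.comp f.continuous_map,
    fun a _ _ hx hy e => by simp [f.map_act, g.map_act]⟩

end GSheaf

variable {𝒢} {Γ : Type t} [Group Γ]

/-- A graded `𝒢`-sheaf of `R`-modules, `component γ x` being `(E_x)_γ`. -/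
structure GradedGSheaf (κ : 𝒢.Grading Γ) : Type (max u v t (w + 1)) where
  toSheaf : GSheaf.{u, v, w} R 𝒢
  component : Γ → ∀ x, Submodule R (toSheaf.stalk x)
  isDirectSum : ∀ x, IsDirectSum fun γ => component γ x
  isOpen_component : ∀ γ, IsOpen {e : toSheaf.Total | e.2 ∈ component γ e.1}
  act_mem : ∀ γ (g : 𝒢.Arr) {x y : 𝒢.Obj} (hx : 𝒢.c g = x) (hy : 𝒢.d g = y),
    ∀ e ∈ component γ x, toSheaf.act g hx hy e ∈ component (γ * κ.deg g) y

namespace GradedGSheaf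

variable {R} {κ : 𝒢.Grading Γ}

/-- A graded morphism of graded `𝒢`-sheaves of `R`-modules. -/
@[ext] structure Hom (E F : GradedGSheaf.{u, v, w} R κ) : Type (max u w) where
  hom : E.toSheaf ⟶ F.toSheaf
  map_mem : ∀ γ x, ∀ e ∈ E.component γ x, hom.map x e ∈ F.component γ x

/-- The category `Gr_R 𝒢` of graded `𝒢`-sheaves of `R`-modules. -/
instance instCategory : Category (GradedGSheaf.{u, v, w} R κ) where
  Hom := Hom
  id E := ⟨𝟙 _, fun _ _ _ h => h⟩
  comp f g := ⟨f.hom ≫ g.hom, fun γ x e h => g.map_mem γ x _ (f.map_mem γ x e h)⟩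

variable (R κ) in
/-- The functor forgetting the grading. -/
def forget : GradedGSheaf.{u, v, w} R κ ⥤ GSheaf.{u, v, w} R 𝒢 where
  obj E := E.toSheaf
  map f := f.hom

/-- The shifted sheaf `E(α)`, with `(E(α)_x)_γ = (E_x)_{αγ}`. -/
def shiftObj (α : Γ) (E : GradedGSheaf.{u, v, w} R κ) : GradedGSheaf.{u, v, w} R κ where
  toSheaf := E.toSheaf
  component γ := E.component (α * γ)
  isDirectSum x := GradedRightModule.isDirectSum_shift (E.isDirectSum x) α
  isOpen_component γ := E.isOpen_component (α * γ)
  act_mem γ g _ _ hx hy e he := mul_assoc α γ _ ▸ E.act_mem (α * γ) g hx hy e he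

variable (R κ) in
/-- The shift functor `𝒯_α : E ↦ E(α)`. -/
def shift (α : Γ) : GradedGSheaf.{u, v, w} R κ ⥤ GradedGSheaf.{u, v, w} R κ where
  obj := shiftObj α
  map f := ⟨f.hom, fun γ x e h => f.map_mem (α * γ) x e h⟩

end GradedGSheaf

end Sheaves

/-! ### The functor of compactly supported sections -/

namespace GSheaf

variable {R : Type v} [CommRing R] {𝒢 : TopGroupoid.{u}} (E : GSheaf.{u, v, w} R 𝒢)

/-- Continuity of a global section `s`. -/
def ContinuousSection (s : ∀ x, E.stalk x) : Prop :=
  Continuous fun x => (⟨x, s x⟩ : E.Total)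

variable {E}

theorem ContinuousSection.add {s s' : ∀ x, E.stalk x} (h : E.ContinuousSection s)
    (h' : E.ContinuousSection s') : E.ContinuousSection (s + s') := by
  have h1 : @Continuous _ (Σ x, E.stalk x × E.stalk x) _
      (E.top.induced (fun q => ⟨q.1, q.2.1⟩) ⊓ E.top.induced (fun q => ⟨q.1, q.2.2⟩))
      (fun x => ⟨x, (s x, s' x)⟩) :=
    continuous_inf_rng.2 ⟨continuous_induced_rng.2 h, continuous_induced_rng.2 h'⟩
  exact @Continuous.comp _ _ _ _ (_) _ _ _ E.continuous_add h1

theorem ContinuousSection.smul {s : ∀ x, E.stalk x} (h : E.ContinuousSection s) (r : R) :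
    E.ContinuousSection (r • s) :=
  (E.continuous_smul r).comp h

theorem ContinuousSection.isOpen_eq {s s' : ∀ x, E.stalk x} (h : E.ContinuousSection s)
    (h' : E.ContinuousSection s') : IsOpen {x | s x = s' x} := by
  have := E.isLocalHomeomorph_proj.isLocallyInjective.isOpen_eqLocus h h' rfl
  convert this using 1
  ext x
  simp

theorem ContinuousSection.isClosed_support {s : ∀ x, E.stalk x} (h : E.ContinuousSection s) :
    IsClosed {x | s x ≠ 0} :=
  ⟨by
    convert h.isOpen_eq (s' := 0) E.continuous_zero using 1
    ext x
    simp⟩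

variable (E) in
/-- The `R`-module `Γ_c(E)` of compactly supported continuous global sections of `E`. -/
def compactSections : Submodule R (∀ x, E.stalk x) where
  carrier := {s | E.ContinuousSection s ∧ IsCompact {x | s x ≠ 0}}
  zero_mem' := ⟨E.continuous_zero, by simp⟩
  add_mem' := by
    rintro s s' ⟨h, hc⟩ ⟨h', hc'⟩
    refine ⟨h.add h', (hc.union hc').of_isClosed_subset (h.add h').isClosed_support ?_⟩
    intro x hx
    by_contra hn
    simp only [Set.mem_union, Set.mem_ofPred_eq, not_or, not_not] at hn
    exact hx (by simp [hn.1, hn.2])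
  smul_mem' := by
    rintro r s ⟨h, hc⟩
    refine ⟨h.smul r, hc.of_isClosed_subset (h.smul r).isClosed_support ?_⟩
    intro x hx h0
    exact hx (by simp [h0])

/-- The action `(sf)(x) = ∑ f(g) s(c g) g`, the sum being over the arrows `g` with `d g = x`. -/
noncomputable def sectionAct (s : ∀ x, E.stalk x) (f : 𝒢.Arr → R) (x : 𝒢.Obj) : E.stalk x :=
  TopGroupoid.fiberSum x f fun g => E.act g.1 rfl g.2 (s (𝒢.c g.1))

theorem act_section (s : ∀ x, E.stalk x) (g : 𝒢.Arr) {x y : 𝒢.Obj} (hx : 𝒢.c g = x)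
    (hy : 𝒢.d g = y) : E.act g rfl hy (s (𝒢.c g)) = E.act g hx hy (s x) := by
  subst hx; rfl

theorem act_congr {g g' : 𝒢.Arr} (h : g = g') {x y : 𝒢.Obj} (hx : 𝒢.c g = x)
    (hy : 𝒢.d g = y) (e : E.stalk x) :
    E.act g hx hy e = E.act g' (h ▸ hx) (h ▸ hy) e := by
  subst h; rfl

theorem sectionAct_charFun_of_mem (s : ∀ x, E.stalk x) {B : Set 𝒢.Arr} (hB : Set.InjOn 𝒢.d B)
    {b : 𝒢.Arr} (hb : b ∈ B) {x : 𝒢.Obj} (hx : 𝒢.d b = x) :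
    sectionAct s (TopGroupoid.charFun R B) x = E.act b rfl hx (s (𝒢.c b)) :=
  TopGroupoid.fiberSum_charFun_of_mem hB _ hb hx

theorem sectionAct_charFun_of_notMem (s : ∀ x, E.stalk x) {B : Set 𝒢.Arr} {x : 𝒢.Obj}
    (hx : x ∉ 𝒢.d '' B) : sectionAct s (TopGroupoid.charFun R B) x = 0 :=
  TopGroupoid.fiberSum_charFun_of_notMem _ hx

theorem ContinuousSection.act {s : ∀ x, E.stalk x} (h : E.ContinuousSection s) :
    Continuous fun g => (⟨𝒢.d g, E.act g rfl rfl (s (𝒢.c g))⟩ : E.Total) :=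
  E.continuous_act.comp
    (f := fun g => (⟨(⟨𝒢.c g, s (𝒢.c g)⟩, g), rfl⟩ : {q : E.Total × 𝒢.Arr // q.1.1 = 𝒢.c q.2}))
    (((h.comp 𝒢.continuous_c).prodMk continuous_id).subtype_mk _)

theorem sectionAct_add_right (s : ∀ x, E.stalk x) (f f' : SteinbergAlgebra R 𝒢) :
    sectionAct s (f.toFun + f'.toFun) = sectionAct s f.toFun + sectionAct s f'.toFun :=
  funext fun _ => fiberSum_add_left f.fiberFinite f'.fiberFinite _ _

theorem sectionAct_smul_right (s : ∀ x, E.stalk x) (r : R) (f : SteinbergAlgebra R 𝒢) :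
    sectionAct s (r • f.toFun) = r • sectionAct s f.toFun :=
  funext fun _ => fiberSum_smul_left f.fiberFinite r _ _

theorem sectionAct_add_left (s s' : ∀ x, E.stalk x) (f : SteinbergAlgebra R 𝒢) :
    sectionAct (s + s') f.toFun = sectionAct s f.toFun + sectionAct s' f.toFun := by
  funext x
  rw [Pi.add_apply, sectionAct, sectionAct, sectionAct, ← fiberSum_add_right f.fiberFinite]
  simp

theorem sectionAct_smul_left (r : R) (s : ∀ x, E.stalk x) (f : SteinbergAlgebra R 𝒢) :
    sectionAct (r • s) f.toFun = r • sectionAct s f.toFun := by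
  funext x
  rw [Pi.smul_apply, sectionAct, sectionAct, ← fiberSum_smul_right f.fiberFinite]
  simp

theorem map_sectionAct {F : GSheaf.{u, v, w} R 𝒢} (φ : E.Hom F) (s : ∀ x, E.stalk x)
    (f : SteinbergAlgebra R 𝒢) (x : 𝒢.Obj) :
    φ.map x (sectionAct s f.toFun x) = sectionAct (fun x => φ.map x (s x)) f.toFun x := by
  rw [sectionAct, map_fiberSum f.fiberFinite]
  simp [sectionAct, φ.map_act]

theorem sectionAct_charFun_charFun (s : ∀ x, E.stalk x) {B C : Set 𝒢.Arr}
    (hB : Set.InjOn 𝒢.d B) (hC : Set.InjOn 𝒢.d C) (hBC : Set.InjOn 𝒢.d (setMul B C)) :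
    sectionAct (sectionAct s (charFun R B)) (charFun R C) =
      sectionAct s (charFun R (setMul B C)) := by
  funext x
  by_cases hx : x ∈ 𝒢.d '' C
  · obtain ⟨k, hk, hkx⟩ := hx
    rw [sectionAct_charFun_of_mem _ hC hk hkx]
    by_cases hy : 𝒢.c k ∈ 𝒢.d '' B
    · obtain ⟨b, hb, hbk⟩ := hy
      have hm : 𝒢.comp b k hbk ∈ setMul B C := ⟨b, hb, k, hk, hbk, rfl⟩
      rw [sectionAct_charFun_of_mem _ hB hb hbk,
        sectionAct_charFun_of_mem _ hBC hm ((𝒢.d_comp _ _ _).trans hkx), E.act_act, act_section]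
    · rw [sectionAct_charFun_of_notMem _ hy, map_zero, sectionAct_charFun_of_notMem]
      rintro ⟨_, ⟨b, hb, k', hk', e, rfl⟩, h⟩
      rw [𝒢.d_comp] at h
      have := hC hk' hk (h.trans hkx.symm)
      subst this
      exact hy ⟨b, hb, e⟩
  · rw [sectionAct_charFun_of_notMem _ hx, sectionAct_charFun_of_notMem]
    rintro ⟨_, ⟨b, hb, k', hk', e, rfl⟩, h⟩
    rw [𝒢.d_comp] at h
    exact hx ⟨k', hk', h⟩

variable [𝒢.IsAmple]

theorem ContinuousSection.sectionAct_charFun {s : ∀ x, E.stalk x} (h : E.ContinuousSection s)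
    {B : Set 𝒢.Arr} (hB : B ∈ 𝒢.compactOpenBisections) :
    E.ContinuousSection (sectionAct s (TopGroupoid.charFun R B)) := by
  have hd := TopGroupoid.IsAmple.isLocalHomeomorph_d (𝒢 := 𝒢)
  refine continuous_iff_continuousAt.2 fun x => ?_
  by_cases hx : x ∈ 𝒢.d '' B
  · obtain ⟨b, hb, rfl⟩ := hx
    unfold ContinuousAt
    rw [← hd.map_nhds_eq, Filter.tendsto_map'_iff]
    beta_reduce
    rw [sectionAct_charFun_of_mem s hB.2.2.1 hb rfl]
    refine (h.act.tendsto b).congr' ?_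
    filter_upwards [hB.2.1.mem_nhds hb] with b' hb'
    simp only [Function.comp]
    rw [sectionAct_charFun_of_mem s hB.2.2.1 hb' rfl]
  · have hcl : IsClosed (𝒢.d '' B) := (hB.1.image 𝒢.continuous_d).isClosed
    refine (E.continuous_zero.continuousAt (x := x)).congr ?_
    filter_upwards [hcl.isOpen_compl.mem_nhds hx] with y hy
    rw [sectionAct_charFun_of_notMem s hy]

theorem sectionAct_charFun_mem {s : ∀ x, E.stalk x} (hs : E.ContinuousSection s)
    {B : Set 𝒢.Arr} (hB : B ∈ 𝒢.compactOpenBisections) :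
    sectionAct s (TopGroupoid.charFun R B) ∈ E.compactSections := by
  have h := hs.sectionAct_charFun hB
  refine ⟨h, (hB.1.image 𝒢.continuous_d).of_isClosed_subset h.isClosed_support ?_⟩
  intro x hx
  by_contra hn
  exact hx (sectionAct_charFun_of_notMem s hn)

theorem sectionAct_mem {s : ∀ x, E.stalk x} (hs : s ∈ E.compactSections)
    (f : SteinbergAlgebra R 𝒢) : sectionAct s f.toFun ∈ E.compactSections := by
  induction f using SteinbergAlgebra.induction with
  | char B hB => exact sectionAct_charFun_mem hs.1 hB
  | add f f' h h' => rw [SteinbergAlgebra.toFun_add, sectionAct_add_right]; exact add_mem h h'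
  | smul r f h =>
    rw [SteinbergAlgebra.toFun_smul, sectionAct_smul_right]; exact Submodule.smul_mem _ _ h

theorem sectionAct_sectionAct (s : ∀ x, E.stalk x) (f f' : SteinbergAlgebra R 𝒢) :
    sectionAct (sectionAct s f.toFun) f'.toFun = sectionAct s (f * f').toFun := by
  induction f using SteinbergAlgebra.induction with
  | add f g h1 h2 =>
    rw [add_mul]
    simp only [SteinbergAlgebra.toFun_add, sectionAct_add_right, sectionAct_add_left, h1, h2]
  | smul r f h1 =>
    rw [SteinbergAlgebra.smul_mul_left']
    simp only [SteinbergAlgebra.toFun_smul, sectionAct_smul_right, sectionAct_smul_left, h1]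
  | char B hB =>
    induction f' using SteinbergAlgebra.induction with
    | add f g h1 h2 =>
      rw [mul_add]
      simp only [SteinbergAlgebra.toFun_add, sectionAct_add_right, h1, h2]
    | smul r f h1 =>
      rw [SteinbergAlgebra.mul_smul_right']
      simp only [SteinbergAlgebra.toFun_smul, sectionAct_smul_right, h1]
    | char C hC =>
      rw [SteinbergAlgebra.char_mul_char]
      exact sectionAct_charFun_charFun s hB.2.2.1 hC.2.2.1 (setMul_mem hB hC).2.2.1

theorem sectionAct_charUnits_of_mem (s : ∀ x, E.stalk x) {U : Set 𝒢.Obj} (hc : IsCompact U)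
    (ho : IsOpen U) {x : 𝒢.Obj} (hx : x ∈ U) :
    sectionAct s (SteinbergAlgebra.charUnits U hc ho : SteinbergAlgebra R 𝒢).toFun x = s x := by
  have h := sectionAct_charFun_of_mem s (units_mem hc ho).2.2.1 (b := 𝒢.one x)
    ⟨x, hx, rfl⟩ (𝒢.d_one x)
  refine h.trans ?_
  rw [act_section s _ (𝒢.c_one x), E.act_one]

theorem sectionAct_charUnits_of_notMem (s : ∀ x, E.stalk x) {U : Set 𝒢.Obj} (hc : IsCompact U)
    (ho : IsOpen U) {x : 𝒢.Obj} (hx : x ∉ U) :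
    sectionAct s (SteinbergAlgebra.charUnits U hc ho : SteinbergAlgebra R 𝒢).toFun x = 0 := by
  refine sectionAct_charFun_of_notMem s ?_
  rintro ⟨_, ⟨y, hy, rfl⟩, h⟩
  rw [𝒢.d_one] at h
  exact hx (h ▸ hy)

variable (E) in
/-- The right `A_R(𝒢)`-module `Γ_c(E)`. -/
noncomputable def gammaCObj : RightModule.{max u w} (SteinbergAlgebra R 𝒢) where
  carrier := E.compactSections
  act := AddMonoidHom.mk' (fun s => AddMonoidHom.mk'
      (fun f => (⟨sectionAct s.1 f.toFun, sectionAct_mem s.2 f⟩ : E.compactSections))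
      fun f f' => Subtype.ext (sectionAct_add_right s.1 f f'))
    fun s s' => AddMonoidHom.ext fun f => Subtype.ext (sectionAct_add_left s.1 s'.1 f)
  act_act s f f' := Subtype.ext (sectionAct_sectionAct s.1 f f')
  unital := by
    rw [eq_top_iff]
    intro s _
    obtain ⟨U, hc, ho, hU⟩ := exists_compactOpen_superset s.2.2
    refine AddSubgroup.subset_closure ⟨s, SteinbergAlgebra.charUnits U hc ho, Subtype.ext ?_⟩
    funext x
    by_cases hx : x ∈ U
    · exact sectionAct_charUnits_of_mem s.1 hc ho hx
    · refine (sectionAct_charUnits_of_notMem s.1 hc ho hx).trans ?_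
      by_contra h
      exact hx (hU fun h' => h h'.symm)

/-- The functor `Γ_c : Mod_R 𝒢 ⥤ Mod A_R(𝒢)`, given on morphisms by `φ ↦ (s ↦ φ ∘ s)`. -/
noncomputable def gammaC (R : Type v) [CommRing R] (𝒢 : TopGroupoid.{u}) [𝒢.IsAmple] :
    GSheaf.{u, v, w} R 𝒢 ⥤ RightModule.{max u w} (SteinbergAlgebra R 𝒢) where
  obj E := E.gammaCObj
  map {E F} φ :=
    { map := AddMonoidHom.mk' (fun s : E.compactSections =>
        (⟨fun x => φ.map x (s.1 x), φ.continuous_map.comp s.2.1,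
          s.2.2.of_isClosed_subset
            (ContinuousSection.isClosed_support (φ.continuous_map.comp s.2.1))
            fun x hx h0 => hx (by simp only [h0, map_zero])⟩ : F.compactSections))
        fun s s' => Subtype.ext (funext fun x => map_add (φ.map x) _ _)
      map_act := fun s f => Subtype.ext (funext fun x => map_sectionAct φ s.1 f x) }

end GSheaf

namespace GradedGSheaf

variable {R : Type v} [CommRing R] {𝒢 : TopGroupoid.{u}} [𝒢.IsAmple] {Γ : Type t} [Group Γ]
  {κ : 𝒢.Grading Γ} (E : GradedGSheaf.{u, v, w} R κ)

/-- The homogeneous component `Γ_c(E)_γ` of sections with values in `E_γ`. -/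
def sectionComponent (γ : Γ) : AddSubgroup E.toSheaf.compactSections where
  carrier := {s | ∀ x, s.1 x ∈ E.component γ x}
  zero_mem' _ := zero_mem _
  add_mem' h h' x := add_mem (h x) (h' x)
  neg_mem' h x := neg_mem (h x)

end GradedGSheaf

namespace GSheaf

variable {R : Type v} [CommRing R] {𝒢 : TopGroupoid.{u}} [𝒢.IsAmple]
  {E : GSheaf.{u, v, w} R 𝒢}

/-- Every germ extends to a compactly supported continuous section. -/
theorem exists_section {x : 𝒢.Obj} (e : E.stalk x) : ∃ s ∈ E.compactSections, s x = e := by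
  classical
  obtain ⟨φ, hφ, hφe⟩ := E.isLocalHomeomorph_proj ⟨x, e⟩
  have hx : x ∈ φ.target := by
    have := φ.map_source hφ
    rwa [← hφe] at this
  obtain ⟨U, hc, ho, hxU, hU⟩ := exists_compactOpen (𝒢 := 𝒢) φ.open_target hx
  have hfst : ∀ y ∈ U, (φ.symm y).1 = y := by
    intro y hy
    have := φ.right_inv (hU hy)
    rwa [← hφe] at this
  let s : ∀ y, E.stalk y := fun y =>
    if h : y ∈ U then (hfst y h) ▸ (φ.symm y).2 else 0
  have hsU : ∀ y ∈ U, (⟨y, s y⟩ : E.Total) = φ.symm y := by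
    intro y hy
    refine Sigma.ext (hfst y hy).symm ?_
    simp only [s, dif_pos hy]
    exact eqRec_heq _ _
  have hs : E.ContinuousSection s := by
    refine continuous_iff_continuousAt.2 fun y => ?_
    by_cases hy : y ∈ U
    · refine (φ.symm.continuousAt (hU hy)).congr ?_
      filter_upwards [ho.mem_nhds hy] with z hz
      exact (hsU z hz).symm
    · refine (E.continuous_zero.continuousAt (x := y)).congr ?_
      filter_upwards [hc.isClosed.isOpen_compl.mem_nhds hy] with z hz
      have : z ∉ U := hz
      simp only [s, dif_neg this]
  refine ⟨s, ⟨hs, hc.of_isClosed_subset hs.isClosed_support ?_⟩, ?_⟩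
  · intro y hy
    by_contra hn
    exact hy (by simp only [s, dif_neg hn])
  · have h1 := hsU x hxU
    have h2 : φ.symm x = ⟨x, e⟩ := by
      have := φ.left_inv hφ
      rwa [← hφe] at this
    rw [h2] at h1
    simpa using h1

end GSheaf

namespace GradedGSheaf

variable {R : Type v} [CommRing R] {𝒢 : TopGroupoid.{u}} [𝒢.IsAmple] {Γ : Type t} [Group Γ]
  {κ : 𝒢.Grading Γ} {E : GradedGSheaf.{u, v, w} R κ}

theorem exists_section {γ : Γ} {x : 𝒢.Obj} {e : E.toSheaf.stalk x} (he : e ∈ E.component γ x) :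
    ∃ s ∈ E.toSheaf.compactSections, s x = e ∧ ∀ y, s y ∈ E.component γ y := by
  obtain ⟨s, hs, rfl⟩ := GSheaf.exists_section e
  have hO : IsOpen {y | s y ∈ E.component γ y} := (E.isOpen_component γ).preimage hs.1
  obtain ⟨U, hc, ho, hxU, hU⟩ := exists_compactOpen (𝒢 := 𝒢) hO he
  refine ⟨_, GSheaf.sectionAct_mem hs (SteinbergAlgebra.charUnits U hc ho),
    GSheaf.sectionAct_charUnits_of_mem s hc ho hxU, fun y => ?_⟩
  by_cases hy : y ∈ U
  · rw [GSheaf.sectionAct_charUnits_of_mem s hc ho hy]; exact hU hy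
  · rw [GSheaf.sectionAct_charUnits_of_notMem s hc ho hy]; exact zero_mem _

/-- Near each point, the homogeneous components of a continuous section are continuous and almost
all zero. -/
theorem local_decomposition {s : ∀ x, E.toSheaf.stalk x} (hs : E.toSheaf.ContinuousSection s)
    (x : 𝒢.Obj) : ∃ (D : Finset Γ) (n : Γ → ∀ y, E.toSheaf.stalk y),
      (∀ γ, E.toSheaf.ContinuousSection (n γ)) ∧
      ∀ᶠ y in 𝓝 x, (∀ γ ∈ D, proj (E.isDirectSum y) γ (s y) = n γ y) ∧
        ∀ γ ∉ D, proj (E.isDirectSum y) γ (s y) = 0 := by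
  obtain ⟨D, -, hD⟩ := exists_sum_proj (E.isDirectSum x) (s x)
  choose n hn hnx hny using fun γ => exists_section (proj_mem (E.isDirectSum x) γ (s x))
  have hsum : ∑ γ ∈ D, n γ ∈ E.toSheaf.compactSections := sum_mem fun γ _ => hn γ
  have hO : IsOpen {y | s y = (∑ γ ∈ D, n γ) y} := hs.isOpen_eq hsum.1
  refine ⟨D, n, fun γ => (hn γ).1, ?_⟩
  have hx : s x = (∑ γ ∈ D, n γ) x := by
    rw [Finset.sum_apply, ← hD]
    exact Finset.sum_congr rfl fun γ _ => by rw [hnx]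
  filter_upwards [hO.mem_nhds hx] with y hy
  have hy' : s y = ∑ γ ∈ D, n γ y := by rw [← Finset.sum_apply]; exact hy
  have key := fun γ => proj_sum (E.isDirectSum y) D (fun γ => n γ y) (fun γ _ => hny γ y) (γ := γ)
  rw [hy']
  exact ⟨fun γ h => (key γ).1 h, fun γ h => (key γ).2 h⟩

variable (E) in
/-- The homogeneous component of degree `γ` of a compactly supported continuous section. -/
noncomputable def sectionProj (γ : Γ) : E.toSheaf.compactSections →+ E.toSheaf.compactSections :=
  AddMonoidHom.mk' (fun s => ⟨fun x => proj (E.isDirectSum x) γ (s.1 x), by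
    have hc : E.toSheaf.ContinuousSection fun x => proj (E.isDirectSum x) γ (s.1 x) := by
      refine continuous_iff_continuousAt.2 fun x => ?_
      obtain ⟨D, n, hn, h⟩ := local_decomposition s.2.1 x
      by_cases hγ : γ ∈ D
      · refine ((hn γ).continuousAt (x := x)).congr ?_
        filter_upwards [h] with y hy
        rw [hy.1 γ hγ]
      · refine (E.toSheaf.continuous_zero.continuousAt (x := x)).congr ?_
        filter_upwards [h] with y hy
        rw [hy.2 γ hγ]
    refine ⟨hc, s.2.2.of_isClosed_subset hc.isClosed_support ?_⟩
    intro x hx h0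
    exact hx (by simp only [h0, map_zero])⟩)
    fun s s' => Subtype.ext (funext fun x => map_add (proj (E.isDirectSum x) γ) _ _)

theorem sectionProj_apply (γ : Γ) (s : E.toSheaf.compactSections) (x : 𝒢.Obj) :
    (E.sectionProj γ s).1 x = proj (E.isDirectSum x) γ (s.1 x) := rfl

theorem isDirectSum_sectionComponent : IsDirectSum E.sectionComponent := by
  classical
  refine isDirectSum_of_proj E.sectionProj ?_ ?_ ?_
  · intro γ s hs
    exact Subtype.ext (funext fun x => proj_of_mem (E.isDirectSum x) (hs x))
  · intro γ δ hne s hs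
    exact Subtype.ext (funext fun x => proj_of_mem_ne (E.isDirectSum x) (hs x) hne)
  · intro s
    have : ∃ D : Finset Γ, ∀ x ∈ {x | s.1 x ≠ 0}, ∀ γ ∉ D, proj (E.isDirectSum x) γ (s.1 x) = 0 := by
      refine s.2.2.induction_on
        (p := fun K => ∃ D : Finset Γ, ∀ x ∈ K, ∀ γ ∉ D, proj (E.isDirectSum x) γ (s.1 x) = 0)
        ⟨∅, by simp⟩ ?_ ?_ ?_
      · rintro K K' hK ⟨D, hD⟩; exact ⟨D, fun x hx => hD x (hK hx)⟩
      · rintro K K' ⟨D, hD⟩ ⟨D', hD'⟩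
        refine ⟨D ∪ D', ?_⟩
        rintro x hx γ hγ
        rw [Finset.notMem_union] at hγ
        rcases hx with hx | hx
        · exact hD x hx γ hγ.1
        · exact hD' x hx γ hγ.2
      · intro x _
        obtain ⟨D, n, -, h⟩ := local_decomposition s.2.1 x
        exact ⟨_, mem_nhdsWithin_of_mem_nhds h, D, fun y hy => hy.2⟩
    obtain ⟨D, hD⟩ := this
    refine ⟨D, fun γ => E.sectionProj γ s, fun γ x => proj_mem (E.isDirectSum x) γ _, ?_⟩
    refine Subtype.ext (funext fun x => ?_)
    rw [AddSubmonoidClass.coe_finsetSum, Finset.sum_apply]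
    simp only [sectionProj_apply]
    by_cases hx : s.1 x = 0
    · simp [hx]
    · obtain ⟨D', h1, h2⟩ := exists_sum_proj (E.isDirectSum x) (s.1 x)
      conv_rhs => rw [← h2]
      refine Finset.sum_congr_of_eq_on_inter ?_ ?_ ?_
      · intro γ _ h; exact h1 γ h
      · intro γ _ h; exact hD x hx γ h
      · intros; rfl

variable (E) in
/-- The graded right `A_R(𝒢)`-module `Γ_c(E)`. -/
noncomputable def gammaCObj :
    GradedRightModule.{max u w} (SteinbergAlgebra.component (R := R) κ) where
  toModule := E.toSheaf.gammaCObj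
  component := E.sectionComponent
  isDirectSum := isDirectSum_sectionComponent
  act_mem γ δ s hs f hf x := by
    change GSheaf.sectionAct s.1 f.toFun x ∈ _
    unfold GSheaf.sectionAct fiberSum
    refine finsum_induction (· ∈ E.component (γ * δ) x) (zero_mem _) (fun _ _ => add_mem) ?_
    rintro ⟨g, hg⟩
    by_cases h0 : f.toFun g = 0
    · simp [h0]
    · refine Submodule.smul_mem _ _ ?_
      have := E.act_mem γ g rfl hg _ (hs (𝒢.c g))
      rwa [hf g h0] at this

/-- The functor `Γ_c : Gr_R 𝒢 ⥤ Gr A_R(𝒢)`. -/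
noncomputable def gammaC (R : Type v) [CommRing R] (κ : 𝒢.Grading Γ) :
    GradedGSheaf.{u, v, w} R κ ⥤
      GradedRightModule.{max u w} (SteinbergAlgebra.component (R := R) κ) where
  obj E := E.gammaCObj
  map φ := ⟨(GSheaf.gammaC R 𝒢).map φ.hom, fun γ s hs x => φ.map_mem γ x _ (hs x)⟩

end GradedGSheaf

/-! ### The sheaf associated with a module -/

namespace RightModule

open SteinbergAlgebra

variable {R : Type v} [CommRing R] {𝒢 : TopGroupoid.{u}} [𝒢.IsAmple]
  (M : RightModule.{w} (SteinbergAlgebra R 𝒢))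

variable {M} in
theorem exists_act_charUnits (m : M.carrier) :
    ∃ U, ∃ hc : IsCompact U, ∃ ho : IsOpen U, M.act m (charUnits U hc ho) = m := by
  have hm : m ∈ AddSubgroup.closure {n | ∃ m a, M.act m a = n} := M.unital ▸ AddSubgroup.mem_top m
  induction hm using AddSubgroup.closure_induction with
  | mem x hx =>
    obtain ⟨n, f, rfl⟩ := hx
    obtain ⟨U, hc, ho, h⟩ := exists_mul_charUnits f
    exact ⟨U, hc, ho, by rw [M.act_act, h]⟩
  | zero => exact ⟨∅, isCompact_empty, isOpen_empty, by simp⟩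
  | neg x _ h =>
    obtain ⟨U, hc, ho, h⟩ := h
    exact ⟨U, hc, ho, by rw [map_neg, AddMonoidHom.neg_apply, h]⟩
  | add x y _ _ h h' =>
    obtain ⟨U, hc, ho, h⟩ := h
    obtain ⟨V, hc', ho', h'⟩ := h'
    refine ⟨U ∪ V, hc.union hc', ho.union ho', ?_⟩
    rw [map_add, AddMonoidHom.add_apply, ← h, ← h', M.act_act, M.act_act,
      charUnits_mul_of_subset _ _ _ _ Set.subset_union_left,
      charUnits_mul_of_subset _ _ _ _ Set.subset_union_right]

/-- The scalar multiplication of a unital right `A_R(𝒢)`-module induced by the `R`-algebra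
structure of `A_R(𝒢)`: `rm = m (r 1_U)` for any compact open `U` such that `m 1_U = m`. -/
noncomputable def rsmul (r : R) (m : M.carrier) : M.carrier :=
  M.act m (r • charUnits _ (exists_act_charUnits m).choose_spec.choose
    (exists_act_charUnits m).choose_spec.choose_spec.choose)

variable {M}

theorem rsmul_eq (r : R) {m : M.carrier} {f : SteinbergAlgebra R 𝒢} (h : M.act m f = m) :
    M.rsmul r m = M.act m (r • f) := by
  have h' := (exists_act_charUnits m).choose_spec.choose_spec.choose_spec
  unfold rsmul
  generalize (charUnits _ _ _ : SteinbergAlgebra R 𝒢) = k at h'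
  obtain ⟨W, hc, ho, hk, hf⟩ := exists_mul_charUnits₂ k f
  have key : ∀ l : SteinbergAlgebra R 𝒢, M.act m l = m → l * charUnits W hc ho = l →
      M.act m (r • l) = M.act m (r • charUnits W hc ho) := by
    intro l h1 h2
    conv_lhs => rw [← h2, ← mul_smul_right', ← M.act_act, h1]
  rw [key k h' hk, key f h hf]

theorem exists_act_charUnits₂ (m n : M.carrier) :
    ∃ U, ∃ hc : IsCompact U, ∃ ho : IsOpen U,
      M.act m (charUnits U hc ho) = m ∧ M.act n (charUnits U hc ho) = n := by
  obtain ⟨U, hc, ho, h⟩ := exists_act_charUnits m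
  obtain ⟨V, hc', ho', h'⟩ := exists_act_charUnits n
  refine ⟨U ∪ V, hc.union hc', ho.union ho', ?_, ?_⟩
  · rw [← h, M.act_act, charUnits_mul_of_subset _ _ _ _ Set.subset_union_left]
  · rw [← h', M.act_act, charUnits_mul_of_subset _ _ _ _ Set.subset_union_right]

/-- The `R`-module structure of a unital right `A_R(𝒢)`-module. -/
noncomputable instance instModule : Module R M.carrier where
  smul := M.rsmul
  one_smul m := by
    obtain ⟨U, hc, ho, h⟩ := exists_act_charUnits m
    exact (rsmul_eq 1 h).trans (by rw [one_smul, h])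
  mul_smul r r' m := by
    obtain ⟨U, hc, ho, h⟩ := exists_act_charUnits m
    change M.rsmul (r * r') m = M.rsmul r (M.rsmul r' m)
    have h1 : M.act (M.rsmul r' m) (charUnits U hc ho) = M.rsmul r' m := by
      rw [rsmul_eq r' h, M.act_act, smul_mul_left', charUnits_mul_of_subset _ _ _ _ subset_rfl]
    rw [rsmul_eq r h1, rsmul_eq r' h, rsmul_eq _ h, M.act_act, smul_mul_left', mul_smul_right',
      charUnits_mul_of_subset _ _ _ _ subset_rfl, smul_smul, mul_comm]
  smul_zero r := (rsmul_eq r (f := 0) (by simp)).trans (by simp)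
  zero_smul m := by
    obtain ⟨U, hc, ho, h⟩ := exists_act_charUnits m
    exact (rsmul_eq 0 h).trans (by simp)
  smul_add r m n := by
    obtain ⟨U, hc, ho, h, h'⟩ := exists_act_charUnits₂ m n
    change M.rsmul r (m + n) = M.rsmul r m + M.rsmul r n
    rw [rsmul_eq r h, rsmul_eq r h', rsmul_eq r (m := m + n) (f := charUnits U hc ho)
      (by rw [map_add, AddMonoidHom.add_apply, h, h']), map_add, AddMonoidHom.add_apply]
  add_smul r r' m := by
    obtain ⟨U, hc, ho, h⟩ := exists_act_charUnits m
    change M.rsmul (r + r') m = M.rsmul r m + M.rsmul r' m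
    rw [rsmul_eq _ h, rsmul_eq _ h, rsmul_eq _ h, add_smul, map_add]

theorem smul_eq (r : R) {m : M.carrier} {f : SteinbergAlgebra R 𝒢} (h : M.act m f = m) :
    r • m = M.act m (r • f) := rsmul_eq r h

theorem act_smul (r : R) (m : M.carrier) (f : SteinbergAlgebra R 𝒢) :
    M.act m (r • f) = r • M.act m f := by
  obtain ⟨U, hc, ho, h⟩ := exists_mul_charUnits f
  rw [smul_eq r (m := M.act m f) (f := charUnits U hc ho) (by rw [M.act_act, h]), M.act_act,
    mul_smul_right', h]

theorem smul_act (r : R) (m : M.carrier) (f : SteinbergAlgebra R 𝒢) :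
    M.act (r • m) f = r • M.act m f := by
  obtain ⟨U, hc, ho, h⟩ := exists_act_charUnits m
  rw [smul_eq r h, M.act_act, smul_mul_left', ← mul_smul_right', ← M.act_act, h, act_smul]

theorem hom_map_smul {N : RightModule.{w} (SteinbergAlgebra R 𝒢)} (φ : M.Hom N) (r : R)
    (m : M.carrier) : φ.map (r • m) = r • φ.map m := by
  obtain ⟨U, hc, ho, h⟩ := exists_act_charUnits m
  rw [smul_eq r h, φ.map_act, smul_eq r (by rw [← φ.map_act, h])]

variable (M) in
/-- The elements of `M` with zero germ at `x`: those `m` with `m 1_U = 0` for some compact open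
neighbourhood `U` of `x`. -/
def zeroGerm (x : 𝒢.Obj) : Submodule R M.carrier where
  carrier := {m | ∃ U, ∃ hc : IsCompact U, ∃ ho : IsOpen U, x ∈ U ∧
    M.act m (charUnits U hc ho) = 0}
  zero_mem' := by
    obtain ⟨U, hc, ho, hx, -⟩ := exists_compactOpen (𝒢 := 𝒢) isOpen_univ (Set.mem_univ x)
    exact ⟨U, hc, ho, hx, by simp⟩
  add_mem' := by
    rintro m n ⟨U, hc, ho, hx, h⟩ ⟨V, hc', ho', hx', h'⟩
    refine ⟨U ∩ V, hc.inter hc', ho.inter ho', ⟨hx, hx'⟩, ?_⟩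
    rw [map_add, AddMonoidHom.add_apply,
      ← charUnits_mul_of_subset (hc.inter hc') (ho.inter ho') hc' ho' Set.inter_subset_right]
    have e : (charUnits (U ∩ V) (hc.inter hc') (ho.inter ho') : SteinbergAlgebra R 𝒢) =
      charUnits V hc' ho' * charUnits U hc ho := by
      rw [charUnits_mul_charUnits]; congr 1; exact Set.inter_comm _ _
    have e' : (charUnits (U ∩ V) (hc.inter hc') (ho.inter ho') : SteinbergAlgebra R 𝒢) =
      charUnits U hc ho * charUnits V hc' ho' := by
      rw [charUnits_mul_charUnits]
    rw [charUnits_mul_of_subset _ _ _ _ Set.inter_subset_right]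
    conv_lhs => enter [1]; rw [e', ← M.act_act, h, map_zero, AddMonoidHom.zero_apply]
    conv_lhs => enter [2]; rw [e, ← M.act_act, h', map_zero, AddMonoidHom.zero_apply]
    exact add_zero 0
  smul_mem' := by
    rintro r m ⟨U, hc, ho, hx, h⟩
    exact ⟨U, hc, ho, hx, by rw [smul_act, h, smul_zero]⟩

variable (M) in
/-- The stalk at `x` of the sheaf of `M`: the direct limit of the modules `M 1_U`, over the sets
`U` that are compact, open and contain `x`, with transition maps `m ↦ m 1_V`. It is realized as the
quotient of `M` identifying `m` and `n` when `m 1_U = n 1_U` for some such `U`. -/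
abbrev Germ (x : 𝒢.Obj) : Type w := M.carrier ⧸ M.zeroGerm x

/-- The germ `[m]_x`. -/
noncomputable def germ (m : M.carrier) (x : 𝒢.Obj) : M.Germ x := (M.zeroGerm x).mkQ m

/-- The germ `[m]_x` as a point of the sheaf space. -/
noncomputable def germPt (m : M.carrier) (x : 𝒢.Obj) : Σ x, M.Germ x := ⟨x, germ m x⟩

theorem germ_eq_iff {m n : M.carrier} {x : 𝒢.Obj} :
    germ m x = germ n x ↔ ∃ U, ∃ hc : IsCompact U, ∃ ho : IsOpen U, x ∈ U ∧
      M.act m (charUnits U hc ho) = M.act n (charUnits U hc ho) := by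
  rw [germ, germ, Submodule.mkQ_apply, Submodule.mkQ_apply, Submodule.Quotient.eq]
  constructor
  · rintro ⟨U, hc, ho, hx, h⟩
    exact ⟨U, hc, ho, hx, by rwa [map_sub, AddMonoidHom.sub_apply, sub_eq_zero] at h⟩
  · rintro ⟨U, hc, ho, hx, h⟩
    exact ⟨U, hc, ho, hx, by rw [map_sub, AddMonoidHom.sub_apply, h, sub_self]⟩

theorem germ_surjective (x : 𝒢.Obj) (e : M.Germ x) : ∃ m, germ m x = e :=
  Submodule.mkQ_surjective _ e

theorem exists_germPt (e : Σ x, M.Germ x) : ∃ m, germPt m e.1 = e := by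
  obtain ⟨x, e⟩ := e
  obtain ⟨m, rfl⟩ := germ_surjective x e
  exact ⟨m, rfl⟩

theorem germ_act_charUnits (m : M.carrier) {U : Set 𝒢.Obj} (hc : IsCompact U) (ho : IsOpen U)
    {x : 𝒢.Obj} (hx : x ∈ U) : germ (M.act m (charUnits U hc ho)) x = germ m x :=
  germ_eq_iff.2 ⟨U, hc, ho, hx, by
    rw [M.act_act, charUnits_mul_of_subset _ _ _ _ subset_rfl]⟩

theorem isOpen_germ_eq (m n : M.carrier) : IsOpen {x | germ m x = germ n x} := by
  rw [isOpen_iff_mem_nhds]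
  intro x hx
  obtain ⟨U, hc, ho, hxU, h⟩ := germ_eq_iff.1 hx
  filter_upwards [ho.mem_nhds hxU] with y hy
  exact germ_eq_iff.2 ⟨U, hc, ho, hy, h⟩

variable (M) in
/-- The basic open sets `(U, m) = {[m]_x | x ∈ U}` of the sheaf space, for `U` compact open and
`m ∈ M 1_U`. -/
def basicOpens : Set (Set (Σ x, M.Germ x)) :=
  {W | ∃ U, ∃ hc : IsCompact U, ∃ ho : IsOpen U, ∃ n : M.carrier,
    W = germPt (M.act n (charUnits U hc ho)) '' U}

/-- The topology of the sheaf space. -/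
instance germTopology : TopologicalSpace (Σ x, M.Germ x) :=
  TopologicalSpace.generateFrom M.basicOpens

theorem germPt_eq_iff {m n : M.carrier} {x y : 𝒢.Obj} :
    germPt m x = germPt n y ↔ x = y ∧ germ m x = germ n x := by
  constructor
  · intro h
    have h1 : x = y := congrArg Sigma.fst h
    subst h1
    exact ⟨rfl, by simpa [germPt] using h⟩
  · rintro ⟨rfl, h⟩
    rw [germPt, germPt, h]

theorem continuous_germPt (m : M.carrier) : Continuous (germPt m) := by
  refine continuous_generateFrom_iff.2 ?_
  rintro _ ⟨U, hc, ho, n, rfl⟩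
  convert ho.inter (isOpen_germ_eq (M.act n (charUnits U hc ho)) m) using 1
  ext x
  constructor
  · rintro ⟨y, hy, h⟩
    obtain ⟨h1, h2⟩ := germPt_eq_iff.1 h
    subst h1
    exact ⟨hy, h2⟩
  · rintro ⟨hx, h⟩
    exact ⟨x, hx, germPt_eq_iff.2 ⟨rfl, h⟩⟩

theorem isOpen_germPt_image (m : M.carrier) {O : Set 𝒢.Obj} (hO : IsOpen O) :
    IsOpen (germPt m '' O) := by
  rw [isOpen_iff_forall_mem_open]
  rintro _ ⟨x, hx, rfl⟩
  obtain ⟨U, hc, ho, hxU, hU⟩ := exists_compactOpen (𝒢 := 𝒢) hO hx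
  refine ⟨germPt (M.act m (charUnits U hc ho)) '' U, ?_,
    TopologicalSpace.isOpen_generateFrom_of_mem ⟨U, hc, ho, m, rfl⟩, x, hxU,
    germPt_eq_iff.2 ⟨rfl, germ_act_charUnits m hc ho hxU⟩⟩
  rintro _ ⟨y, hy, rfl⟩
  exact ⟨y, hU hy, germPt_eq_iff.2 ⟨rfl, (germ_act_charUnits m hc ho hy).symm⟩⟩

theorem continuous_germ_fst : Continuous (Sigma.fst : (Σ x, M.Germ x) → 𝒢.Obj) := by
  refine continuous_def.2 fun O hO => ?_
  have : (Sigma.fst : (Σ x, M.Germ x) → 𝒢.Obj) ⁻¹' O = ⋃ m : M.carrier, germPt m '' O := by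
    ext e
    obtain ⟨m, hm⟩ := exists_germPt e
    constructor
    · intro he
      exact Set.mem_iUnion.2 ⟨m, e.1, he, hm⟩
    · intro he
      obtain ⟨n, y, hy, rfl⟩ := Set.mem_iUnion.1 he
      exact hy
  rw [this]
  exact isOpen_iUnion fun m => isOpen_germPt_image m hO

theorem eventually_germPt (m : M.carrier) (x : 𝒢.Obj) :
    ∀ᶠ e in 𝓝 (germPt m x), e = germPt m e.1 := by
  filter_upwards [(isOpen_germPt_image m isOpen_univ).mem_nhds ⟨x, trivial, rfl⟩] with e he
  obtain ⟨y, -, rfl⟩ := he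
  rfl

theorem isLocalHomeomorph_germ_fst :
    IsLocalHomeomorph (Sigma.fst : (Σ x, M.Germ x) → 𝒢.Obj) := by
  intro e
  obtain ⟨m, hm⟩ := exists_germPt e
  refine ⟨{ toFun := Sigma.fst
            invFun := germPt m
            source := germPt m '' Set.univ
            target := Set.univ
            map_source' := fun _ _ => trivial
            map_target' := fun y _ => ⟨y, trivial, rfl⟩
            left_inv' := ?_
            right_inv' := fun _ _ => rfl
            open_source := isOpen_germPt_image m isOpen_univ
            open_target := isOpen_univ
            continuousOn_toFun := continuous_germ_fst.continuousOn
            continuousOn_invFun := (continuous_germPt m).continuousOn }, ⟨e.1, trivial, hm⟩, rfl⟩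
  rintro _ ⟨y, -, rfl⟩
  rfl

/-! The action of arrows on germs. -/

theorem germ_act_char_eq {B C : Set 𝒢.Arr} (hB : B ∈ 𝒢.compactOpenBisections)
    (hC : C ∈ 𝒢.compactOpenBisections) {g : 𝒢.Arr} (hgB : g ∈ B) (hgC : g ∈ C)
    (m : M.carrier) {y : 𝒢.Obj} (hy : 𝒢.d g = y) :
    germ (M.act m (char B hB)) y = germ (M.act m (char C hC)) y := by
  subst hy
  obtain ⟨D, hD, hgD, hDs⟩ := (IsAmple.isTopologicalBasis (𝒢 := 𝒢)).exists_subset_of_mem_open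
    (Set.mem_inter hgB hgC) (hB.2.1.inter hC.2.1)
  have ho : IsOpen (𝒢.d '' D) := (IsAmple.isLocalHomeomorph_d (𝒢 := 𝒢)).isOpenMap _ hD.2.1
  have hc : IsCompact (𝒢.d '' D) := hD.1.image 𝒢.continuous_d
  have key : ∀ {B : Set 𝒢.Arr} (hB : B ∈ 𝒢.compactOpenBisections), D ⊆ B →
      (char B hB * charUnits (𝒢.d '' D) hc ho : SteinbergAlgebra R 𝒢) = char D hD := by
    intro B hB hDB
    rw [charUnits, char_mul_char]
    refine char_congr ?_ _ _
    rw [setMul_units]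
    ext b
    constructor
    · rintro ⟨hb, b', hb', e⟩
      rwa [hB.2.2.1 hb (hDB hb') e.symm]
    · intro hb
      exact ⟨hDB hb, b, hb, rfl⟩
  exact germ_eq_iff.2 ⟨_, hc, ho, ⟨g, hgD, rfl⟩, by
    rw [M.act_act, M.act_act, key hB (hDs.trans Set.inter_subset_left),
      key hC (hDs.trans Set.inter_subset_right)]⟩

theorem germ_act_char_zero {B : Set 𝒢.Arr} (hB : B ∈ 𝒢.compactOpenBisections) {g : 𝒢.Arr}
    (hg : g ∈ B) {m : M.carrier} {x y : 𝒢.Obj} (hx : 𝒢.c g = x) (hy : 𝒢.d g = y)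
    (hm : m ∈ M.zeroGerm x) : M.act m (char B hB) ∈ M.zeroGerm y := by
  subst hx hy
  obtain ⟨U, hc, ho, hxU, h⟩ := hm
  have hO : IsOpen (𝒢.d '' (B ∩ 𝒢.c ⁻¹' U)) :=
    (IsAmple.isLocalHomeomorph_d (𝒢 := 𝒢)).isOpenMap _
      (hB.2.1.inter (ho.preimage 𝒢.continuous_c))
  obtain ⟨V, hc', ho', hyV, hV⟩ := exists_compactOpen (𝒢 := 𝒢) hO ⟨g, ⟨hg, hxU⟩, rfl⟩
  refine ⟨V, hc', ho', hyV, ?_⟩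
  have : (char B hB * charUnits V hc' ho' : SteinbergAlgebra R 𝒢) =
      charUnits U hc ho * (char B hB * charUnits V hc' ho') := by
    rw [charUnits, charUnits, char_mul_char, char_mul_char]
    refine char_congr ?_ _ _
    rw [setMul_units, units_setMul]
    refine (Set.inter_eq_left.2 ?_).symm
    rintro b ⟨hb, hbV⟩
    obtain ⟨b', ⟨hb', hb'U⟩, e⟩ := hV hbV
    rwa [hB.2.2.1 hb' hb e] at hb'U
  rw [M.act_act, this, ← M.act_act, h, map_zero, AddMonoidHom.zero_apply]

/-- Every arrow lies in a compact open bisection. -/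
theorem exists_bisection (g : 𝒢.Arr) : ∃ B ∈ 𝒢.compactOpenBisections, g ∈ B := by
  obtain ⟨B, hB, hg, -⟩ := (IsAmple.isTopologicalBasis (𝒢 := 𝒢)).exists_subset_of_mem_open
    (Set.mem_univ g) isOpen_univ
  exact ⟨B, hB, hg⟩

/-- The map `m ↦ m f`. -/
noncomputable def actLinear (f : SteinbergAlgebra R 𝒢) : M.carrier →ₗ[R] M.carrier where
  toFun m := M.act m f
  map_add' m n := by rw [map_add, AddMonoidHom.add_apply]
  map_smul' r m := smul_act r m f

/-- The action `[m]_x g = [m 1_B]_y` of an arrow `g` from `y` to `x`, where `B` is any compact open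
bisection containing `g`. -/
noncomputable def germAct (g : 𝒢.Arr) {x y : 𝒢.Obj} (hx : 𝒢.c g = x) (hy : 𝒢.d g = y) :
    M.Germ x →ₗ[R] M.Germ y :=
  Submodule.mapQ _ _
    (actLinear (char (exists_bisection g).choose (exists_bisection g).choose_spec.1))
    fun _ hm => germ_act_char_zero _ (exists_bisection g).choose_spec.2 hx hy hm

theorem germAct_germ (g : 𝒢.Arr) {x y : 𝒢.Obj} (hx : 𝒢.c g = x) (hy : 𝒢.d g = y)
    {B : Set 𝒢.Arr} (hB : B ∈ 𝒢.compactOpenBisections) (hg : g ∈ B) (m : M.carrier) :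
    germAct g hx hy (germ m x) = germ (M.act m (char B hB)) y :=
  germ_act_char_eq _ hB (exists_bisection g).choose_spec.2 hg m hy

variable (M) in
/-- The `𝒢`-sheaf of `R`-modules `Sh(M)`. -/
noncomputable def shObj : GSheaf.{u, v, w} R 𝒢 where
  stalk := M.Germ
  top := germTopology
  isLocalHomeomorph_proj := isLocalHomeomorph_germ_fst
  continuous_zero := continuous_germPt 0
  continuous_add := by
    refine @continuous_iff_continuousAt _ _ (_) _ _ |>.2 ?_
    rintro ⟨x, e, e'⟩
    obtain ⟨m, rfl⟩ := germ_surjective x e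
    obtain ⟨n, rfl⟩ := germ_surjective x e'
    let t₁ : TopologicalSpace (Σ x, M.Germ x × M.Germ x) :=
      germTopology.induced (fun q => ⟨q.1, q.2.1⟩)
    let t₂ : TopologicalSpace (Σ x, M.Germ x × M.Germ x) :=
      germTopology.induced (fun q => ⟨q.1, q.2.2⟩)
    let t₀ : TopologicalSpace (Σ x, M.Germ x × M.Germ x) := t₁ ⊓ t₂
    have h1 : Continuous fun q : Σ x, M.Germ x × M.Germ x => (⟨q.1, q.2.1⟩ : Σ x, M.Germ x) :=
      @continuous_inf_dom_left _ _ _ t₁ t₂ _ continuous_induced_dom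
    have h2 : Continuous fun q : Σ x, M.Germ x × M.Germ x => (⟨q.1, q.2.2⟩ : Σ x, M.Germ x) :=
      @continuous_inf_dom_right _ _ _ t₁ t₂ _ continuous_induced_dom
    have h3 : Continuous fun q : Σ x, M.Germ x × M.Germ x => germPt (m + n) q.1 :=
      (continuous_germPt (m + n)).comp (continuous_germ_fst.comp h1)
    refine (h3.continuousAt (x := ⟨x, germ m x, germ n x⟩)).congr ?_
    filter_upwards [h1.continuousAt.eventually (eventually_germPt m x),
      h2.continuousAt.eventually (eventually_germPt n x)] with q hq hq'
    obtain ⟨y, a, b⟩ := q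
    have ha : a = germ m y := by simpa [germPt] using hq
    have hb : b = germ n y := by simpa [germPt] using hq'
    subst ha hb
    rfl
  continuous_smul r := by
    refine continuous_iff_continuousAt.2 fun e => ?_
    obtain ⟨m, hm⟩ := exists_germPt e
    have h3 : Continuous fun q : Σ x, M.Germ x => germPt (r • m) q.1 :=
      (continuous_germPt (r • m)).comp continuous_germ_fst
    refine h3.continuousAt.congr ?_
    rw [← hm]
    filter_upwards [eventually_germPt m e.1] with q hq
    rw [hq]
    rfl
  act := germAct
  continuous_act := by
    refine continuous_iff_continuousAt.2 ?_
    rintro ⟨⟨e, g⟩, he⟩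
    obtain ⟨m, hm⟩ := exists_germPt e
    obtain ⟨B, hB, hg⟩ := exists_bisection g
    have h1 : Continuous fun q : {q : (Σ x, M.Germ x) × 𝒢.Arr // q.1.1 = 𝒢.c q.2} => q.1.1 :=
      continuous_fst.comp continuous_subtype_val
    have h2 : Continuous fun q : {q : (Σ x, M.Germ x) × 𝒢.Arr // q.1.1 = 𝒢.c q.2} => q.1.2 :=
      continuous_snd.comp continuous_subtype_val
    have h3 := (continuous_germPt (M.act m (char B hB))).comp (𝒢.continuous_d.comp h2)
    refine (h3.continuousAt (x := ⟨(e, g), he⟩)).congr ?_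
    have h4 : ∀ᶠ q in 𝓝 e, q = germPt m q.1 := hm ▸ eventually_germPt m e.1
    filter_upwards [(h1.continuousAt (x := ⟨(e, g), he⟩)).eventually h4,
      (h2.continuousAt (x := ⟨(e, g), he⟩)).eventually (hB.2.1.mem_nhds hg)] with q hq hq'
    obtain ⟨⟨⟨y, a⟩, k⟩, hk⟩ := q
    have ha : a = germ m y := by simpa [germPt] using hq
    subst ha
    exact Sigma.ext rfl (heq_of_eq (germAct_germ k hk.symm rfl hB hq' m).symm)
  act_one x e := by
    obtain ⟨m, rfl⟩ := germ_surjective x e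
    obtain ⟨U, hc, ho, hx, -⟩ := exists_compactOpen (𝒢 := 𝒢) isOpen_univ (Set.mem_univ x)
    rw [germAct_germ _ _ _ (units_mem hc ho) ⟨x, hx, rfl⟩]
    exact germ_act_charUnits m hc ho hx
  act_act g h x y z hx hy hy' hz e := by
    obtain ⟨m, rfl⟩ := germ_surjective x e
    obtain ⟨B, hB, hg⟩ := exists_bisection g
    obtain ⟨C, hC, hh⟩ := exists_bisection h
    rw [germAct_germ g hx hy hB hg, germAct_germ h hy' hz hC hh, M.act_act, char_mul_char,
      germAct_germ _ _ _ (setMul_mem hB hC) ⟨g, hg, h, hh, _, rfl⟩]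

/-- The map `[m]_x ↦ [φ(m)]_x` induced by a homomorphism `φ`. -/
noncomputable def shMap {M N : RightModule.{w} (SteinbergAlgebra R 𝒢)} (φ : M.Hom N) :
    M.shObj.Hom N.shObj where
  map x := Submodule.mapQ (M.zeroGerm x) (N.zeroGerm x)
    { toFun := φ.map
      map_add' := map_add φ.map
      map_smul' := hom_map_smul φ } (by
        rintro m ⟨U, hc, ho, hx, h⟩
        refine ⟨U, hc, ho, hx, ?_⟩
        change N.act (φ.map m) _ = 0
        rw [← φ.map_act, h, map_zero])
  continuous_map := by
    refine continuous_iff_continuousAt.2 fun (e : Σ x, M.Germ x) => ?_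
    obtain ⟨m, hm⟩ := exists_germPt e
    have h3 : Continuous fun q : Σ x, M.Germ x => germPt (φ.map m) q.1 :=
      (continuous_germPt (φ.map m)).comp continuous_germ_fst
    refine ContinuousAt.congr h3.continuousAt ?_
    rw [← hm]
    filter_upwards [eventually_germPt m e.1] with q hq
    rw [hq]
    rfl
  map_act g x y hx hy e := by
    obtain ⟨m, rfl⟩ := germ_surjective x e
    obtain ⟨B, hB, hg⟩ := exists_bisection g
    change _ = germAct g hx hy (germ (φ.map m) x)
    rw [germAct_germ g hx hy hB hg, ← φ.map_act]
    change Submodule.mapQ _ _ _ _ (germAct g hx hy (germ m x)) = _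
    rw [germAct_germ g hx hy hB hg]
    rfl

/-- The functor `Sh : Mod A_R(𝒢) ⥤ Mod_R 𝒢`. -/
noncomputable def sh (R : Type v) [CommRing R] (𝒢 : TopGroupoid.{u}) [𝒢.IsAmple] :
    RightModule.{w} (SteinbergAlgebra R 𝒢) ⥤ GSheaf.{u, v, w} R 𝒢 where
  obj M := M.shObj
  map φ := shMap φ
  map_id M := by
    refine GSheaf.Hom.ext (funext fun x => LinearMap.ext fun e => ?_)
    obtain ⟨m, rfl⟩ := germ_surjective x e
    rfl
  map_comp φ ψ := by
    refine GSheaf.Hom.ext (funext fun x => LinearMap.ext fun e => ?_)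
    obtain ⟨m, rfl⟩ := germ_surjective x e
    rfl

end RightModule

namespace GradedRightModule

open SteinbergAlgebra RightModule

variable {R : Type v} [CommRing R] {𝒢 : TopGroupoid.{u}} [𝒢.IsAmple] {Γ : Type t} [Group Γ]
  {κ : 𝒢.Grading Γ} (M : GradedRightModule.{w} (SteinbergAlgebra.component (R := R) κ))

theorem smul_charUnits_mem (κ : 𝒢.Grading Γ) (r : R) {U : Set 𝒢.Obj} (hc : IsCompact U)
    (ho : IsOpen U) : r • (charUnits U hc ho : SteinbergAlgebra R 𝒢) ∈ SteinbergAlgebra.component κ (1 : Γ) := by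
  intro g hg
  have : g ∈ units U := by
    by_contra hn
    refine hg ?_
    change r • (units U).indicator (1 : 𝒢.Arr → R) g = 0
    rw [Set.indicator_of_notMem hn, smul_zero]
  obtain ⟨x, -, rfl⟩ := this
  exact κ.deg_one x

variable {M} in
theorem smul_mem {γ : Γ} (r : R) {m : M.toModule.carrier} (hm : m ∈ M.component γ) :
    r • m ∈ M.component γ := by
  obtain ⟨U, hc, ho, h⟩ := exists_act_charUnits m
  rw [RightModule.smul_eq r h]
  have := M.act_mem γ 1 m hm _ (smul_charUnits_mem κ r hc ho)
  rwa [mul_one] at this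

variable {M} in
theorem act_charUnits_mem {γ : Γ} {m : M.toModule.carrier} (hm : m ∈ M.component γ)
    {U : Set 𝒢.Obj} (hc : IsCompact U) (ho : IsOpen U) :
    M.toModule.act m (charUnits U hc ho) ∈ M.component γ := by
  have := M.act_mem γ 1 m hm _ (smul_charUnits_mem κ (1 : R) hc ho)
  rwa [mul_one, one_smul] at this

/-- The homogeneous component `{[m]_x | m ∈ M_γ}` of degree `γ` of the stalk at `x`. -/
noncomputable def germComponent (γ : Γ) (x : 𝒢.Obj) : Submodule R (M.toModule.Germ x) where
  carrier := {e | ∃ m ∈ M.component γ, germ m x = e}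
  zero_mem' := ⟨0, zero_mem _, rfl⟩
  add_mem' := by
    rintro _ _ ⟨m, hm, rfl⟩ ⟨n, hn, rfl⟩
    exact ⟨m + n, add_mem hm hn, rfl⟩
  smul_mem' := by
    rintro r _ ⟨m, hm, rfl⟩
    exact ⟨r • m, smul_mem r hm, rfl⟩

theorem proj_act_charUnits (γ : Γ) (m : M.toModule.carrier) {U : Set 𝒢.Obj} (hc : IsCompact U)
    (ho : IsOpen U) : proj M.isDirectSum γ (M.toModule.act m (charUnits U hc ho)) =
      M.toModule.act (proj M.isDirectSum γ m) (charUnits U hc ho) := by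
  obtain ⟨D, h0, hD⟩ := exists_sum_proj M.isDirectSum m
  conv_lhs => rw [← hD, map_sum, AddMonoidHom.finsetSum_apply]
  have key := proj_sum M.isDirectSum D
    (fun γ => M.toModule.act (proj M.isDirectSum γ m) (charUnits U hc ho))
    (fun γ _ => act_charUnits_mem (proj_mem _ γ m) hc ho) (γ := γ)
  by_cases hγ : γ ∈ D
  · exact key.1 hγ
  · rw [key.2 hγ, h0 γ hγ, map_zero, AddMonoidHom.zero_apply]

/-- The projection `[m]_x ↦ [m_γ]_x`. -/
noncomputable def germProj (x : 𝒢.Obj) (γ : Γ) : M.toModule.Germ x →+ M.toModule.Germ x :=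
  QuotientAddGroup.map (M.toModule.zeroGerm x).toAddSubgroup (M.toModule.zeroGerm x).toAddSubgroup
    (proj M.isDirectSum γ) (by
      rintro m ⟨U, hc, ho, hx, h⟩
      exact ⟨U, hc, ho, hx, by rw [← proj_act_charUnits, h, map_zero]⟩)

theorem germProj_germ (x : 𝒢.Obj) (γ : Γ) (m : M.toModule.carrier) :
    M.germProj x γ (germ m x) = germ (proj M.isDirectSum γ m) x := rfl

theorem isDirectSum_germComponent (x : 𝒢.Obj) : IsDirectSum fun γ => M.germComponent γ x := by
  refine isDirectSum_of_proj (M.germProj x) ?_ ?_ ?_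
  · rintro γ _ ⟨m, hm, rfl⟩
    rw [germProj_germ, proj_of_mem _ hm]
  · rintro γ δ hne _ ⟨m, hm, rfl⟩
    rw [germProj_germ, proj_of_mem_ne _ hm hne]; rfl
  · intro e
    obtain ⟨m, rfl⟩ := germ_surjective x e
    obtain ⟨D, -, hD⟩ := exists_sum_proj M.isDirectSum m
    refine ⟨D, fun γ => germ (proj M.isDirectSum γ m) x, fun γ => ⟨_, proj_mem _ _ _, rfl⟩, ?_⟩
    conv_rhs => rw [← hD]
    exact (map_sum (M.toModule.zeroGerm x).mkQ _ _).symm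

/-- The graded `𝒢`-sheaf `Sh(M)` of a graded module. -/
noncomputable def shObj : GradedGSheaf.{u, v, w} R κ where
  toSheaf := M.toModule.shObj
  component := M.germComponent
  isDirectSum := M.isDirectSum_germComponent
  isOpen_component γ := by
    have : {e : M.toModule.shObj.Total | e.2 ∈ M.germComponent γ e.1} =
        ⋃ m ∈ M.component γ, germPt m '' Set.univ := by
      ext e
      constructor
      · rintro ⟨m, hm, h⟩
        exact Set.mem_biUnion hm ⟨e.1, trivial, Sigma.ext rfl (heq_of_eq h)⟩
      · intro he
        obtain ⟨m, hm, y, -, rfl⟩ := Set.mem_iUnion₂.1 he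
        exact ⟨m, hm, rfl⟩
    refine Eq.mpr (congrArg IsOpen this) ?_
    exact isOpen_biUnion fun m _ => isOpen_germPt_image m isOpen_univ
  act_mem := by
    rintro γ g x y hx hy _ ⟨m, hm, rfl⟩
    have hO : IsOpen (κ.deg ⁻¹' {κ.deg g}) := κ.isLocallyConstant_deg _
    obtain ⟨B, hB, hg, hBO⟩ := (IsAmple.isTopologicalBasis (𝒢 := 𝒢)).exists_subset_of_mem_open
      (show g ∈ κ.deg ⁻¹' {κ.deg g} from rfl) hO
    refine ⟨M.toModule.act m (char B hB), ?_, (germAct_germ g hx hy hB hg m).symm⟩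
    refine M.act_mem γ _ m hm _ fun k hk => ?_
    have : k ∈ B := by
      by_contra hn
      exact hk (Set.indicator_of_notMem hn _)
    exact hBO this

/-- The functor `Sh : Gr A_R(𝒢) ⥤ Gr_R 𝒢`. -/
noncomputable def sh (R : Type v) [CommRing R] (κ : 𝒢.Grading Γ) :
    GradedRightModule.{w} (SteinbergAlgebra.component (R := R) κ) ⥤
      GradedGSheaf.{u, v, w} R κ where
  obj M := M.shObj
  map {M N} φ := ⟨(RightModule.sh R 𝒢).map φ.hom, by
    rintro γ x _ ⟨m, hm, rfl⟩
    exact ⟨φ.hom.map m, φ.map_mem γ m hm, rfl⟩⟩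
  map_id M := GradedGSheaf.Hom.ext ((RightModule.sh R 𝒢).map_id M.toModule)
  map_comp φ ψ := GradedGSheaf.Hom.ext ((RightModule.sh R 𝒢).map_comp φ.hom ψ.hom)

end GradedRightModule

/-!
The equivalence is given by two explicit natural transformations.

* For a graded `𝒢`-sheaf `E`, evaluation of germs `[s]_x ↦ s x` is a morphism `Sh(Γ_c(E)) → E`
  (`GSheaf.evalGerm`). It is surjective on stalks because every point of a stalk extends to a
  compactly supported section, and injective because two continuous sections of a local
  homeomorphism that agree at a point agree near it. A morphism of sheaves that is bijective on
  stalks is a bijective local homeomorphism of sheaf spaces, hence invertible.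
* For a graded unital module `M`, sending `m` to the section `x ↦ [m]_x` is a homomorphism
  `M → Γ_c(Sh(M))` (`RightModule.germSection`). Its bijectivity (`germSection_injective`,
  `germSection_surjective`) is a compactness argument: compact open sets of units can be made
  disjoint, so elements `m 1_U` with prescribed germs on finitely many compact open sets can be
  glued to a single element of `M`, which is the sheaf condition for compactly supported sections.

A bijection of graded objects that preserves degrees also reflects them (`mem_of_map_mem`), so the
inverses are graded. The compatibilities with the forgetful and the shift functors hold
definitionally, since the functors and the shifts leave the underlying objects untouched.
-/

/-! ### Degree-preserving maps between direct sums -/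

namespace GradedDirectSum

variable {Γ : Type*} {M M' : Type*} {S S' : Type*} [AddCommGroup M] [AddCommGroup M']
  [SetLike S M] [AddSubmonoidClass S M] [SetLike S' M'] [AddSubmonoidClass S' M']
  {N : Γ → S} {N' : Γ → S'}

theorem proj_map (h : IsDirectSum N) (h' : IsDirectSum N') (f : M →+ M')
    (hf : ∀ γ, ∀ m ∈ N γ, f m ∈ N' γ) (γ : Γ) (m : M) :
    proj h' γ (f m) = f (proj h γ m) := by
  obtain ⟨D, h0, hD⟩ := exists_sum_proj h m
  have key := proj_sum h' D (fun γ => f (proj h γ m)) (fun γ _ => hf γ _ (proj_mem h γ m)) (γ := γ)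
  rw [← map_sum, hD] at key
  by_cases hγ : γ ∈ D
  · exact key.1 hγ
  · rw [key.2 hγ, h0 γ hγ, map_zero]

/-- An injective degree-preserving map reflects degrees. -/
theorem mem_of_map_mem (h : IsDirectSum N) (h' : IsDirectSum N') (f : M →+ M')
    (hf : ∀ γ, ∀ m ∈ N γ, f m ∈ N' γ) (hinj : Function.Injective f) {γ : Γ} {m : M}
    (hm : f m ∈ N' γ) : m ∈ N γ := by
  have : m = proj h γ m := hinj (by rw [← proj_map h h' f hf, proj_of_mem h' hm])
  rw [this]
  exact proj_mem h γ m

end GradedDirectSum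

/-! ### Bijective morphisms are isomorphisms -/

namespace GradedRightModule

theorem isIso_of_bijective {A : Type a} [NonUnitalRing A] {Γ : Type t} [Group Γ]
    {𝒜 : Γ → AddSubgroup A} {M N : GradedRightModule.{w} 𝒜} (f : M ⟶ N)
    (hf : Function.Bijective f.hom.map) : IsIso f := by
  let e := AddEquiv.ofBijective f.hom.map hf
  have he : ∀ n, f.hom.map (e.symm n) = n := e.apply_symm_apply
  have he' : ∀ m, e.symm (f.hom.map m) = m := e.symm_apply_apply
  let g : N ⟶ M :=
    { hom :=
        { map := e.symm.toAddMonoidHom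
          map_act := fun n a => hf.1 (by
            change f.hom.map (e.symm _) = f.hom.map (M.toModule.act (e.symm n) a)
            rw [f.hom.map_act, he, he]) }
      map_mem := fun γ n hn => mem_of_map_mem M.isDirectSum N.isDirectSum f.hom.map
        f.map_mem hf.1 (by
          change f.hom.map (e.symm n) ∈ _
          rwa [he]) }
  exact ⟨g, Hom.ext (RightModule.Hom.ext (AddMonoidHom.ext he')),
    Hom.ext (RightModule.Hom.ext (AddMonoidHom.ext he))⟩

end GradedRightModule

namespace GSheaf

variable {R : Type v} [CommRing R] {𝒢 : TopGroupoid.{u}} {E F : GSheaf.{u, v, w} R 𝒢}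

/-- A morphism of sheaves is a local homeomorphism of sheaf spaces; if it is bijective on stalks,
its inverse is therefore continuous. -/
theorem Hom.continuous_inverse (φ : E.Hom F) (hφ : ∀ x, Function.Bijective (φ.map x)) :
    Continuous fun e : F.Total =>
      (⟨e.1, (LinearEquiv.ofBijective (φ.map e.1) (hφ e.1)).symm e.2⟩ : E.Total) := by
  have hl : IsLocalHomeomorph fun e : E.Total => (⟨e.1, φ.map e.1 e.2⟩ : F.Total) :=
    IsLocalHomeomorph.of_comp (g := (Sigma.fst : F.Total → 𝒢.Obj)) E.isLocalHomeomorph_proj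
      F.isLocalHomeomorph_proj φ.continuous_map
  let Φ : E.Total ≃ F.Total :=
    Equiv.sigmaCongrRight fun x => (LinearEquiv.ofBijective (φ.map x) (hφ x)).toEquiv
  exact (Φ.toHomeomorphOfContinuousOpen φ.continuous_map hl.isOpenMap).symm.continuous

end GSheaf

namespace GradedGSheaf

theorem isIso_of_bijective {R : Type v} [CommRing R] {𝒢 : TopGroupoid.{u}} {Γ : Type t} [Group Γ]
    {κ : 𝒢.Grading Γ} {E F : GradedGSheaf.{u, v, w} R κ} (f : E ⟶ F)
    (hf : ∀ x, Function.Bijective (f.hom.map x)) : IsIso f := by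
  let e x := LinearEquiv.ofBijective (f.hom.map x) (hf x)
  have he : ∀ x n, f.hom.map x ((e x).symm n) = n := fun x => (e x).apply_symm_apply
  have he' : ∀ x m, (e x).symm (f.hom.map x m) = m := fun x => (e x).symm_apply_apply
  let g : F ⟶ E :=
    { hom :=
        { map := fun x => (e x).symm
          continuous_map := f.hom.continuous_inverse hf
          map_act := fun g x y hx hy n => (hf y).1 (by
            change f.hom.map y ((e y).symm _) =
              f.hom.map y (E.toSheaf.act g hx hy ((e x).symm n))
            rw [f.hom.map_act, he, he]) }
      map_mem := fun γ x n hn => mem_of_map_mem (E.isDirectSum x) (F.isDirectSum x)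
        (f.hom.map x).toAddMonoidHom (fun γ => f.map_mem γ x) (hf x).1 (by
          change f.hom.map x ((e x).symm n) ∈ _
          rwa [he]) }
  exact ⟨g, Hom.ext (GSheaf.Hom.ext (funext fun x => LinearMap.ext (he' x))),
    Hom.ext (GSheaf.Hom.ext (funext fun x => LinearMap.ext (he x)))⟩

end GradedGSheaf

/-! ### Evaluation of germs of sections -/

namespace GSheaf

open SteinbergAlgebra

variable {R : Type v} [CommRing R] {𝒢 : TopGroupoid.{u}} [𝒢.IsAmple]
  (E : GSheaf.{u, v, w} R 𝒢)

/-- Evaluation of sections at `x`. It is `R`-linear for the `R`-module structure on `Γ_c(E)` that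
comes from the action of the Steinberg algebra, which is the pointwise one. -/
noncomputable def evalSection (x : 𝒢.Obj) : E.gammaCObj.carrier →ₗ[R] E.stalk x where
  toFun s := s.1 x
  map_add' _ _ := rfl
  map_smul' r s := by
    obtain ⟨U, hc, ho, h⟩ := RightModule.exists_act_charUnits s
    rw [RightModule.smul_eq r h]
    conv_rhs => rw [← h]
    exact congrFun (sectionAct_smul_right s.1 r (charUnits U hc ho)) x

variable {E}

theorem evalSection_eq_zero_iff {x : 𝒢.Obj} {s : E.gammaCObj.carrier} :
    E.evalSection x s = 0 ↔ s ∈ E.gammaCObj.zeroGerm x := by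
  constructor
  · intro h
    have hO : IsOpen {y | s.1 y = 0} := s.2.1.isOpen_eq (s' := 0) E.continuous_zero
    obtain ⟨U, hc, ho, hx, hU⟩ := exists_compactOpen (𝒢 := 𝒢) hO h
    refine ⟨U, hc, ho, hx, Subtype.ext (funext fun y => ?_)⟩
    by_cases hy : y ∈ U
    · exact (sectionAct_charUnits_of_mem s.1 hc ho hy).trans (hU hy)
    · exact sectionAct_charUnits_of_notMem s.1 hc ho hy
  · rintro ⟨U, hc, ho, hx, h⟩
    have h1 := congrFun (congrArg Subtype.val h) x
    exact (sectionAct_charUnits_of_mem s.1 hc ho hx).symm.trans h1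

/-- The morphism `Sh(Γ_c(E)) → E`, `[s]_x ↦ s x`. -/
noncomputable def evalGerm (E : GSheaf.{u, v, max u w} R 𝒢) : E.gammaCObj.shObj.Hom E where
  map x := (E.gammaCObj.zeroGerm x).liftQ (E.evalSection x)
    fun _ hs => evalSection_eq_zero_iff.2 hs
  continuous_map := by
    refine continuous_iff_continuousAt.2 fun (e : Σ x, E.gammaCObj.Germ x) => ?_
    obtain ⟨s, hs⟩ := RightModule.exists_germPt e
    have h : Continuous fun q : Σ x, E.gammaCObj.Germ x => (⟨q.1, s.1 q.1⟩ : E.Total) :=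
      s.2.1.comp RightModule.continuous_germ_fst
    refine ContinuousAt.congr h.continuousAt ?_
    rw [← hs]
    filter_upwards [RightModule.eventually_germPt s e.1] with q hq
    rw [hq]
    rfl
  map_act g x y hx hy e := by
    obtain ⟨s, rfl⟩ := RightModule.germ_surjective x e
    obtain ⟨B, hB, hg⟩ := RightModule.exists_bisection g
    change Submodule.liftQ _ _ _ (RightModule.germAct g hx hy (RightModule.germ s x)) = _
    rw [RightModule.germAct_germ g hx hy hB hg]
    exact (sectionAct_charFun_of_mem s.1 hB.2.2.1 hg hy).trans (act_section s.1 g hx hy)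

theorem evalGerm_bijective (E : GSheaf.{u, v, max u w} R 𝒢) (x : 𝒢.Obj) :
    Function.Bijective (E.evalGerm.map x) := by
  constructor
  · refine (injective_iff_map_eq_zero _).2 fun e he => ?_
    obtain ⟨s, rfl⟩ := RightModule.germ_surjective x e
    exact (Submodule.Quotient.mk_eq_zero _).2 (evalSection_eq_zero_iff.1 he)
  · intro e
    obtain ⟨s, hs, rfl⟩ := exists_section e
    exact ⟨RightModule.germ (M := E.gammaCObj) ⟨s, hs⟩ x, rfl⟩

end GSheaf

/-! ### The section of germs of an element of a module -/

namespace RightModule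

open SteinbergAlgebra

variable {R : Type v} [CommRing R] {𝒢 : TopGroupoid.{u}} [𝒢.IsAmple]
  {M : RightModule.{w} (SteinbergAlgebra R 𝒢)}

theorem germ_act_char_of_notMem (m : M.carrier) {B : Set 𝒢.Arr}
    (hB : B ∈ 𝒢.compactOpenBisections) {x : 𝒢.Obj} (hx : x ∉ 𝒢.d '' B) :
    germ (M.act m (char B hB)) x = 0 := by
  have hcl : IsClosed (𝒢.d '' B) := (hB.1.image 𝒢.continuous_d).isClosed
  obtain ⟨U, hc, ho, hxU, hU⟩ := exists_compactOpen (𝒢 := 𝒢) hcl.isOpen_compl hx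
  refine (Submodule.Quotient.mk_eq_zero _).2 ⟨U, hc, ho, hxU, ?_⟩
  have h0 : (char B hB * charUnits U hc ho : SteinbergAlgebra R 𝒢) = 0 := by
    rw [charUnits, char_mul_char]
    ext1
    refine (congrArg (charFun R) ?_).trans (Set.indicator_empty _)
    rw [setMul_units]
    exact Set.eq_empty_of_forall_notMem fun b hb => hU hb.2 ⟨b, hb.1, rfl⟩
  rw [M.act_act, h0, map_zero]

theorem germ_act_charUnits_of_notMem (m : M.carrier) {U : Set 𝒢.Obj} (hc : IsCompact U)
    (ho : IsOpen U) {x : 𝒢.Obj} (hx : x ∉ U) : germ (M.act m (charUnits U hc ho)) x = 0 := by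
  refine germ_act_char_of_notMem m _ ?_
  rintro ⟨_, ⟨y, hy, rfl⟩, h⟩
  rw [𝒢.d_one] at h
  exact hx (h ▸ hy)

theorem germ_act (m : M.carrier) (f : SteinbergAlgebra R 𝒢) (x : 𝒢.Obj) :
    germ (M.act m f) x = GSheaf.sectionAct (E := M.shObj) (germ m) f.toFun x := by
  induction f using SteinbergAlgebra.induction with
  | char B hB =>
    by_cases hx : x ∈ 𝒢.d '' B
    · obtain ⟨b, hb, hbx⟩ := hx
      refine Eq.trans ?_
        (GSheaf.sectionAct_charFun_of_mem (E := M.shObj) (germ m) hB.2.2.1 hb hbx).symm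
      exact (germAct_germ b rfl hbx hB hb m).symm
    · exact (germ_act_char_of_notMem m hB hx).trans
        (GSheaf.sectionAct_charFun_of_notMem (E := M.shObj) (germ m) hx).symm
  | add f f' h h' =>
    refine Eq.trans ?_
      (congrFun (GSheaf.sectionAct_add_right (E := M.shObj) (germ m) f f') x).symm
    refine Eq.trans ?_ (congrArg₂ (· + ·) h h')
    rw [map_add]
    rfl
  | smul r f h =>
    refine Eq.trans ?_
      (congrFun (GSheaf.sectionAct_smul_right (E := M.shObj) (germ m) r f) x).symm
    refine Eq.trans ?_ (congrArg (r • ·) h)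
    rw [act_smul]
    rfl

theorem germ_mem_compactSections (m : M.carrier) : germ m ∈ M.shObj.compactSections := by
  have hs : M.shObj.ContinuousSection (germ m) := continuous_germPt m
  obtain ⟨U, hc, ho, h⟩ := exists_act_charUnits m
  refine ⟨hs, hc.of_isClosed_subset hs.isClosed_support fun x hx => ?_⟩
  by_contra hn
  refine hx ?_
  rw [← h]
  exact germ_act_charUnits_of_notMem m hc ho hn

/-- The homomorphism `M → Γ_c(Sh(M))` sending `m` to the section `x ↦ [m]_x`. -/
noncomputable def germSection (M : RightModule.{max u w} (SteinbergAlgebra R 𝒢)) :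
    M.Hom M.shObj.gammaCObj where
  map := AddMonoidHom.mk'
    (fun m => (⟨germ m, germ_mem_compactSections m⟩ : M.shObj.compactSections))
    fun _ _ => rfl
  map_act m f := Subtype.ext (funext fun x => germ_act m f x)

/-- An element all of whose germs vanish is zero: finitely many compact open sets `U` with
`m 1_U = 0` cover a compact open set on which `m` is supported. -/
theorem eq_zero_of_germ_eq_zero {m : M.carrier} (h : ∀ x, germ m x = 0) : m = 0 := by
  obtain ⟨U, hc, ho, hU⟩ := exists_act_charUnits m
  -- The annihilation of `m` is inherited by smaller sets, so it can be glued over disjoint unions.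
  have hsub : ∀ {V W : Set 𝒢.Obj} (hc : IsCompact V) (ho : IsOpen V) (hc' : IsCompact W)
      (ho' : IsOpen W), W ⊆ V → M.act m (charUnits V hc ho) = 0 →
      M.act m (charUnits W hc' ho') = 0 := by
    intro V W hc ho hc' ho' hWV hV
    have : (charUnits W hc' ho' : SteinbergAlgebra R 𝒢) =
        charUnits V hc ho * charUnits W hc' ho' := by
      rw [charUnits_mul_charUnits]; congr 1; exact (Set.inter_eq_right.2 hWV).symm
    rw [this, ← M.act_act, hV, map_zero, AddMonoidHom.zero_apply]
  have key : ∃ W, ∃ hc : IsCompact W, ∃ ho : IsOpen W, U ⊆ W ∧ M.act m (charUnits W hc ho) = 0 := by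
    refine hc.induction_on (p := fun K => ∃ W, ∃ hc : IsCompact W, ∃ ho : IsOpen W, K ⊆ W ∧
      M.act m (charUnits W hc ho) = 0) ?_ ?_ ?_ ?_
    · refine ⟨∅, isCompact_empty, isOpen_empty, subset_rfl, ?_⟩
      have : (charUnits ∅ isCompact_empty isOpen_empty : SteinbergAlgebra R 𝒢) = 0 := by
        ext1
        exact (congrArg (charFun R) (Set.image_empty _)).trans (Set.indicator_empty _)
      rw [this, map_zero]
    · rintro K K' hK ⟨W, h1, h2, h3, h4⟩
      exact ⟨W, h1, h2, hK.trans h3, h4⟩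
    · rintro K K' ⟨V, h1, h2, h3, h4⟩ ⟨W, h1', h2', h3', h4'⟩
      refine ⟨V ∪ W, h1.union h1', h2.union h2', Set.union_subset_union h3 h3', ?_⟩
      have hcd : IsCompact (W \ V) := h1'.diff h2
      have hod : IsOpen (W \ V) := h2'.sdiff h1.isClosed
      have : (charUnits (V ∪ W) (h1.union h1') (h2.union h2') : SteinbergAlgebra R 𝒢) =
          charUnits V h1 h2 + charUnits (W \ V) hcd hod := by
        ext1
        change charFun R (units (V ∪ W)) = charFun R (units V) + charFun R (units (W \ V))
        rw [← Set.union_sdiff_self, units, Set.image_union]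
        refine Set.indicator_union_of_disjoint ?_ _
        exact (Set.disjoint_image_iff 𝒢.isEmbedding_one.injective).2 Set.disjoint_sdiff_right
      rw [this, map_add, h4, zero_add]
      exact hsub h1' h2' hcd hod Set.sdiff_subset h4'
    · intro x _
      obtain ⟨V, h1, h2, h3, h4⟩ := (Submodule.Quotient.mk_eq_zero _).1 (h x)
      exact ⟨V, mem_nhdsWithin_of_mem_nhds (h2.mem_nhds h3), V, h1, h2, subset_rfl, h4⟩
  obtain ⟨W, hc', ho', hUW, h0⟩ := key
  rw [← hU]
  exact hsub hc' ho' hc ho hUW h0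

theorem germSection_injective (M : RightModule.{max u w} (SteinbergAlgebra R 𝒢)) :
    Function.Injective M.germSection.map :=
  (injective_iff_map_eq_zero _).2 fun _ h =>
    eq_zero_of_germ_eq_zero fun x => congrFun (congrArg Subtype.val h) x

theorem germSection_surjective (M : RightModule.{max u w} (SteinbergAlgebra R 𝒢)) :
    Function.Surjective M.germSection.map := by
  rintro ⟨s, hs, hsc⟩
  have key : ∃ W, IsCompact W ∧ IsOpen W ∧ {x | s x ≠ 0} ⊆ W ∧
      ∃ m : M.carrier, (∀ x ∈ W, germ m x = s x) ∧ ∀ x ∉ W, germ m x = 0 := by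
    refine hsc.induction_on (p := fun K => ∃ W, IsCompact W ∧ IsOpen W ∧ K ⊆ W ∧
      ∃ m : M.carrier, (∀ x ∈ W, germ m x = s x) ∧ ∀ x ∉ W, germ m x = 0) ?_ ?_ ?_ ?_
    · exact ⟨∅, isCompact_empty, isOpen_empty, subset_rfl, 0, fun _ h => h.elim, fun _ _ => rfl⟩
    · rintro K K' hK ⟨W, h1, h2, h3, h4⟩
      exact ⟨W, h1, h2, hK.trans h3, h4⟩
    · rintro K K' ⟨V, h1, h2, h3, m, h4, h5⟩ ⟨W, h1', h2', h3', n, h4', h5'⟩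
      have hcd : IsCompact (W \ V) := h1'.diff h2
      have hod : IsOpen (W \ V) := h2'.sdiff h1.isClosed
      -- Cutting `n` down to `W \ V` leaves the germs of `m` on `V` unchanged.
      have hg : ∀ x, germ (m + M.act n (charUnits (W \ V) hcd hod)) x =
          germ m x + germ (M.act n (charUnits (W \ V) hcd hod)) x := fun _ => rfl
      refine ⟨V ∪ W, h1.union h1', h2.union h2', Set.union_subset_union h3 h3',
        m + M.act n (charUnits (W \ V) hcd hod), fun x hx => ?_, fun x hx => ?_⟩
      · rw [hg]
        by_cases hV : x ∈ V
        · rw [germ_act_charUnits_of_notMem n hcd hod fun h => h.2 hV, add_zero, h4 x hV]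
        · have hW := hx.resolve_left hV
          rw [germ_act_charUnits n hcd hod ⟨hW, hV⟩, h5 x hV, zero_add, h4' x hW]
      · rw [hg, h5 x fun h => hx (.inl h),
          germ_act_charUnits_of_notMem n hcd hod fun h => hx (.inr h.1), add_zero]
    · intro x _
      obtain ⟨m, hm⟩ := germ_surjective x (s x)
      have hO : IsOpen {y | germ m y = s y} :=
        GSheaf.ContinuousSection.isOpen_eq (E := M.shObj) (continuous_germPt m) hs
      obtain ⟨U, hc, ho, hxU, hU⟩ := exists_compactOpen (𝒢 := 𝒢) hO hm
      exact ⟨U, mem_nhdsWithin_of_mem_nhds (ho.mem_nhds hxU), U, hc, ho, subset_rfl,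
        M.act m (charUnits U hc ho), fun y hy => (germ_act_charUnits m hc ho hy).trans (hU hy),
        fun y hy => germ_act_charUnits_of_notMem m hc ho hy⟩
  obtain ⟨W, -, -, hW, m, h1, h2⟩ := key
  refine ⟨m, Subtype.ext (funext fun x => ?_)⟩
  by_cases hx : x ∈ W
  · exact h1 x hx
  · exact (h2 x hx).trans (not_not.1 fun h => hx (hW fun h' => h h'.symm))

end RightModule

/-! ### The equivalence of categories -/

section Equivalence

variable {R : Type v} [CommRing R] {𝒢 : TopGroupoid.{u}} [𝒢.IsAmple] {Γ : Type t} [Group Γ]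
  (κ : 𝒢.Grading Γ)

/-- The natural isomorphism `Sh(Γ_c(E)) ≅ E`, `[s]_x ↦ s x`. -/
noncomputable def evalGermIso :
    GradedGSheaf.gammaC R κ ⋙ GradedRightModule.sh R κ ≅ 𝟭 (GradedGSheaf.{u, v, max u w} R κ) :=
  haveI (E : GradedGSheaf.{u, v, max u w} R κ) : IsIso
      (⟨E.toSheaf.evalGerm, fun _ x _ ⟨_, hs, he⟩ => he ▸ hs x⟩ :
        E.gammaCObj.shObj ⟶ E) :=
    GradedGSheaf.isIso_of_bijective _ fun x => GSheaf.evalGerm_bijective E.toSheaf x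
  NatIso.ofComponents (fun E => asIso (X := E.gammaCObj.shObj) (Y := E)
      ⟨E.toSheaf.evalGerm, fun _ x _ ⟨_, hs, he⟩ => he ▸ hs x⟩) fun {E F} φ => by
    refine GradedGSheaf.Hom.ext (GSheaf.Hom.ext (funext fun x => LinearMap.ext fun e => ?_))
    obtain ⟨s, rfl⟩ := RightModule.germ_surjective x e
    rfl

/-- The natural isomorphism `M ≅ Γ_c(Sh(M))`, `m ↦ (x ↦ [m]_x)`. -/
noncomputable def germSectionIso :
    𝟭 (GradedRightModule.{max u w} (SteinbergAlgebra.component (R := R) κ)) ≅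
      GradedRightModule.sh R κ ⋙ GradedGSheaf.gammaC R κ :=
  haveI (M : GradedRightModule.{max u w} (SteinbergAlgebra.component (R := R) κ)) : IsIso
      (⟨M.toModule.germSection, fun _ m hm _ => ⟨m, hm, rfl⟩⟩ : M ⟶ M.shObj.gammaCObj) :=
    GradedRightModule.isIso_of_bijective _
      ⟨M.toModule.germSection_injective, M.toModule.germSection_surjective⟩
  NatIso.ofComponents (fun M => asIso (X := M) (Y := M.shObj.gammaCObj)
      ⟨M.toModule.germSection, fun _ m hm _ => ⟨m, hm, rfl⟩⟩) fun _ => rfl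

end Equivalence

theorem proposition3p12 (𝒢 : TopGroupoid.{u}) [𝒢.IsAmple] {Γ : Type t} [Group Γ]
    (κ : 𝒢.Grading Γ) (R : Type v) [CommRing R] :
    (∃ e : GradedGSheaf.{u, v, max u w} R κ ≌
        GradedRightModule.{max u w} (SteinbergAlgebra.component (R := R) κ),
      e.functor = GradedGSheaf.gammaC R κ ∧ e.inverse = GradedRightModule.sh R κ) ∧
    (GradedGSheaf.gammaC R κ ⋙ GradedRightModule.forget (SteinbergAlgebra.component (R := R) κ) =
        GradedGSheaf.forget.{u, v, max u w} R κ ⋙ GSheaf.gammaC R 𝒢) ∧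
    (GradedRightModule.sh R κ ⋙ GradedGSheaf.forget.{u, v, max u w} R κ =
        GradedRightModule.forget (SteinbergAlgebra.component (R := R) κ) ⋙ RightModule.sh R 𝒢) ∧
    ∀ α : Γ,
      GradedGSheaf.shift.{u, v, max u w} R κ α ⋙ GradedGSheaf.gammaC R κ =
        GradedGSheaf.gammaC R κ ⋙
          GradedRightModule.shift (SteinbergAlgebra.component (R := R) κ) α ∧
      GradedRightModule.shift (SteinbergAlgebra.component (R := R) κ) α ⋙
          GradedRightModule.sh R κ =
        GradedRightModule.sh R κ ⋙ GradedGSheaf.shift.{u, v, max u w} R κ α := by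
  refine ⟨⟨CategoryTheory.Equivalence.mk (GradedGSheaf.gammaC R κ) (GradedRightModule.sh R κ)
    (evalGermIso.{u, v, w} κ).symm (germSectionIso.{u, v, w} κ).symm, rfl, rfl⟩,
    rfl, rfl, fun α => ⟨rfl, rfl⟩⟩
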